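/- Graphs are finite, simple and undirected. $P_m$ denotes the path on $m$ vertices, and a graph is $P_m$-free if it contains no induced subgraph isomorphic to $P_m$. The vertices of an $n$-vertex graph carry distinct identifiers on $O(\log n)$ bits, namely in $\{1,\dots,n^c\}$ for a fixed constant $c$. Given an assignment of certificates (bit strings) to the vertices, the view of a vertex $v$ at distance $d$ consists of the vertices at distance at most $d$ from $v$ with their identifiers and certificates, and of all edges between these vertices except those joining two vertices at distance exactly $d$ from $v$. A local certification of size $s$ with verification radius $d$ for a graph property $\mathcal P$ is a verification algorithm, that is, a function of the view at distance $d$ with values accept/reject, the same for all graphs, identifier assignments and vertices, such that for every $n$-vertex graph $G$ and every identifier assignment: (1) if $G$ satisfies $\mathcal P$, there is an assignment of certificates of at most $s(n)$ bits for which every vertex accepts; (2) if $G$ does not satisfy $\mathcal P$, then for every assignment of certificates (of any size) at least one vertex rejects. **Theorem.** For every $k\ge 2$ (and every $c$) there is a function $s(n)=O(n^{3/2}\log^2 n)$ such that the property of being $P_{\lceil 14k/3\rceil-1}$-free has a local certification of size $s$ with verification radius $k$. The implied constant may depend on $k$ and $c$. -/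

import Mathlib

open Filter Asymptotics

/-- `G` is `H`-free: it contains no *induced* subgraph isomorphic to `H`
(`IsIndContained` is the existence of a graph embedding, i.e. an injective map preserving
both adjacency and non-adjacency). -/
def InducedFree {U V : Type} (H : SimpleGraph U) (G : SimpleGraph V) : Prop :=
  ¬ H.IsIndContained G

/-- Unique identifiers on `O(log n)` bits: an injective map from the vertices of an `n`-vertex
graph to `{1, …, n ^ c}`. -/
def IsIdentifierAssignment (c : ℕ) {V : Type} [Fintype V] (ident : V → ℕ) : Prop :=
  Function.Injective ident ∧ ∀ v, 1 ≤ ident v ∧ ident v ≤ Fintype.card V ^ c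

/-- What a vertex of a network can see: its own identifier, the identifiers of the visible vertices
together with their certificates (bit strings), and the visible edges. Vertices occur only
through their identifiers. -/
@[ext]
structure LocalView where
  /-- the identifier of the vertex whose view this is -/
  center : ℕ
  /-- the visible vertices, each given by its identifier together with its certificate -/
  labels : Set (ℕ × List Bool)
  /-- the visible edges, each given by the identifiers of its endpoints -/
  edges : Set (Sym2 ℕ)

/-- The view at distance `d` of the vertex `v`: the vertices at distance at most `d` from `v`, with
their identifiers and certificates, and the edges between these vertices, except those joining
two vertices at distance exactly `d`. Distances are `ℕ∞`-valued, so that vertices in other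
connected components are at distance `⊤`. -/
def viewAt {V : Type} (G : SimpleGraph V) (ident : V → ℕ) (cert : V → List Bool)
    (d : ℕ) (v : V) : LocalView where
  center := ident v
  labels := {p | ∃ u, G.edist v u ≤ d ∧ p = (ident u, cert u)}
  edges := {e | ∃ u w, G.Adj u w ∧ G.edist v u ≤ d ∧ G.edist v w ≤ d ∧
    ¬ (G.edist v u = d ∧ G.edist v w = d) ∧ e = s(ident u, ident w)}

/-- There is a local certification of size `s` with verification radius `d` for the graph
property `P`, on networks whose `n`-vertex members carry unique identifiers in `{1, …, n ^ c}`.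
The verification algorithm `accept` is one function of the view at distance `d`, the same for
all graphs, all identifier assignments and all vertices.
* Completeness: if `G` satisfies `P`, some assignment of certificates of at most `s n` bits makes
  every vertex accept.
* Soundness: if `G` does not satisfy `P`, then for every assignment of certificates (of any size)
  at least one vertex rejects. -/
def HasLocalCertification (P : ∀ V : Type, SimpleGraph V → Prop) (d c : ℕ) (s : ℕ → ℕ) : Prop :=
  ∃ accept : LocalView → Bool,
    ∀ (V : Type) [Fintype V] (G : SimpleGraph V) (ident : V → ℕ),
      IsIdentifierAssignment c ident →
        (P V G → ∃ cert : V → List Bool,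
          (∀ v, (cert v).length ≤ s (Fintype.card V)) ∧
            ∀ v, accept (viewAt G ident cert d v) = true) ∧
        (¬ P V G → ∀ cert : V → List Bool,
          ∃ v, accept (viewAt G ident cert d v) = false)

/-! Write k = r + 1 and let N be the number of vertices of the excluded path, so 3N < 14k. Call a
vertex large if its degree is at least about √n · log n. Honest certificates all contain the edges
with a small end, the list of large vertices, their classes (transitive closure of being at distance
at most 2r) and a global table. Each certificate also holds a private table and the adjacency rows
of about √n vertices, those of one colour. By `exists_coloring` the neighbours of every large vertex
carry all colours, so a vertex within r of a large one can read the rows of all large vertices off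
these neighbours. It thus assembles a whole graph, its belief, and checks that the belief has no
induced path on N vertices. Certificates have O(n^{3/2} log n) facts of O(log n) bits each.

With arbitrary certificates, vertices within r of the same large vertex read the same neighbours.
Hence a class shares one belief, and each large vertex checks its own row in it. A belief near a
class can therefore be wrong only about edges inside other classes.

Suppose an induced path p exists in the true graph H. If it avoids large vertices, the list of edges
with a small end shows it. Otherwise it is carried over into the belief of a single vertex v. Around
each foreign class A, the part of p within some distance h ≤ r of A is replaced by a part realized
in the belief of v with the same positions at distance exactly h. If p meets distance h only once,
the global table promises such a part. If it meets distance h exactly twice, the private table at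
either of the two positions does, provided that v sees it within k. Classes are more than 2r apart,
so the replacements do not interfere (`Beliefs.glue`).

Call a class hard if p meets every distance 0, …, r from it at least twice. If some class met by p
has no other hard class beside it, its large vertices refute p. Three hard classes would use 6k > N
positions. For two, `exists_visible_level` finds a distance from one of them that is met exactly
twice, with one of these positions closer than 2k to the other class. A vertex within r of that
other class and within k of this position refutes p (`Beliefs.no_path`). -/

/-! ### Counting level sets of integer functions with unit steps. -/

/-- Discrete intermediate value theorem for integer sequences that move by at most one. -/
lemma exists_eq_of_steps_le_one {f : ℕ → ℕ} {a b c : ℕ} (hab : a ≤ b)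
    (hf : ∀ i, a ≤ i → i < b → f (i + 1) ≤ f i + 1)
    (ha : f a ≤ c) (hb : c ≤ f b) : ∃ i, a ≤ i ∧ i ≤ b ∧ f i = c := by
  induction b, hab using Nat.le_induction with
  | base => exact ⟨a, le_rfl, le_rfl, by omega⟩
  | succ b hab ih =>
    by_cases h : c ≤ f b
    · obtain ⟨i, h1, h2, h3⟩ := ih (fun i h1 h2 => hf i h1 (by omega)) h
      exact ⟨i, h1, by omega, h3⟩
    · have := hf b hab (by omega)
      exact ⟨b + 1, by omega, le_rfl, by omega⟩

lemma exists_eq_of_steps_ge_neg_one {f : ℕ → ℕ} {a b c : ℕ} (hab : a ≤ b)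
    (hf : ∀ i, a ≤ i → i < b → f i ≤ f (i + 1) + 1)
    (ha : c ≤ f a) (hb : f b ≤ c) : ∃ i, a ≤ i ∧ i ≤ b ∧ f i = c := by
  induction b, hab using Nat.le_induction with
  | base => exact ⟨a, le_rfl, le_rfl, by omega⟩
  | succ b hab ih =>
    by_cases h : f b ≤ c
    · obtain ⟨i, h1, h2, h3⟩ := ih (fun i h1 h2 => hf i h1 (by omega)) h
      exact ⟨i, h1, by omega, h3⟩
    · have := hf b hab (by omega)
      exact ⟨b + 1, by omega, le_rfl, by omega⟩

/-- The indices below `N` at which `f` takes the value `h`. -/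
def levelSet (N : ℕ) (f : ℕ → ℕ) (h : ℕ) : Finset ℕ := {s ∈ Finset.range N | f s = h}

lemma mem_levelSet {N : ℕ} {f : ℕ → ℕ} {h s : ℕ} :
    s ∈ levelSet N f h ↔ s < N ∧ f s = h := by simp [levelSet]

/-- `f` moves by at most one at each step below `N`. -/
def SmallSteps (N : ℕ) (f : ℕ → ℕ) : Prop :=
  ∀ i, i + 1 < N → f (i + 1) ≤ f i + 1 ∧ f i ≤ f (i + 1) + 1

lemma card_levels_ge {N : ℕ} {f : ℕ → ℕ} {a b c : ℕ}
    (h : ∀ x, a ≤ x → x < b → c ≤ (levelSet N f x).card) :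
    c * (b - a) ≤ ({s ∈ Finset.range N | a ≤ f s ∧ f s < b} : Finset ℕ).card := by
  have hmap : ∀ s ∈ ({s ∈ Finset.range N | a ≤ f s ∧ f s < b} : Finset ℕ),
      f s ∈ Finset.Ico a b := by
    intro s hs
    simp only [Finset.mem_filter, Finset.mem_range] at hs
    simpa using hs.2
  rw [Finset.card_eq_sum_card_fiberwise hmap]
  have : ∀ x ∈ Finset.Ico a b, c ≤
      ({s ∈ ({s ∈ Finset.range N | a ≤ f s ∧ f s < b} : Finset ℕ) | f s = x}).card := by
    intro x hx
    rw [Finset.mem_Ico] at hx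
    refine (h x hx.1 hx.2).trans (Finset.card_le_card ?_)
    intro s hs
    rw [mem_levelSet] at hs
    simp only [Finset.mem_filter, Finset.mem_range]
    exact ⟨⟨hs.1, by omega⟩, hs.2⟩
  have h2 := Finset.sum_le_sum this
  simp only [Finset.sum_const, Nat.card_Ico, smul_eq_mul] at h2
  rw [mul_comm]; exact h2

/-- If every index on the level `h` of `f` is far from the zeros of `g`, many indices lie above
level `h` of `f` and at level at least `k` of `g`. -/
lemma card_above_level_ge {N k h : ℕ} {f g : ℕ → ℕ} (hf : SmallSteps N f) (hg : SmallSteps N g)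
    {a x₀ : ℕ} (ha : a < N) (hga : g a = 0) (hfa : h < f a) (hx₀ : x₀ ∈ levelSet N f h)
    (hfar : ∀ x ∈ levelSet N f h, 2 * k ≤ g x) :
    k ≤ ({s ∈ Finset.range N | h < f s ∧ k ≤ g s} : Finset ℕ).card := by
  have key : ∃ φ : ℕ → ℕ, ∀ c ∈ Finset.Ico k (2 * k), g (φ c) = c ∧ φ c < N ∧ h < f (φ c) := by
    suffices H : ∀ c, ∃ i, c ∈ Finset.Ico k (2 * k) → g i = c ∧ i < N ∧ h < f i by
      choose φ hφ using H
      exact ⟨φ, hφ⟩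
    intro c
    by_cases hc : c ∈ Finset.Ico k (2 * k)
    swap
    · exact ⟨0, fun h => absurd h hc⟩
    rw [Finset.mem_Ico] at hc
    rw [mem_levelSet] at hx₀
    rcases le_total a x₀ with hax | hxa
    -- Take the first visit `x` to level `h` after the zero `a` of `g`. Before it `f` stays above
    -- `h`, while `g` climbs from 0 to at least `2 * k` and takes every value in `[k, 2k)` on the
    -- way.
    · have hex : ∃ x, a ≤ x ∧ x < N ∧ f x = h := ⟨x₀, hax, hx₀⟩
      obtain ⟨hx1, hx2, hx3⟩ := Nat.find_spec hex
      have hmin := fun y => @Nat.find_min _ _ hex y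
      generalize Nat.find hex = x at *
      have hgx := hfar x (mem_levelSet.2 ⟨hx2, hx3⟩)
      obtain ⟨i, h1, h2, h3⟩ := exists_eq_of_steps_le_one (f := g) (c := c) hx1
        (fun i _ h2 => (hg i (by omega)).1) (by omega) (by omega)
      have hix : i < x := lt_of_le_of_ne h2 (by rintro rfl; omega)
      refine ⟨i, fun _ => ⟨h3, by omega, ?_⟩⟩
      by_contra hcon
      obtain ⟨j, j1, j2, j3⟩ := exists_eq_of_steps_ge_neg_one (f := f) (c := h) h1
        (fun j _ h2 => (hf j (by omega)).2) (by omega) (by omega)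
      exact hmin j (by omega) ⟨j1, by omega, j3⟩
    -- The mirror image: the last visit to level `h` before `a`, with `d` counting backwards.
    · have hex : ∃ d, d ≤ a ∧ f (a - d) = h := ⟨a - x₀, by omega, by
        rw [Nat.sub_sub_self hxa]; exact hx₀.2⟩
      obtain ⟨hx1, hx2⟩ := Nat.find_spec hex
      have hmin := fun y => @Nat.find_min _ _ hex y
      generalize Nat.find hex = d at *
      have hgx := hfar (a - d) (mem_levelSet.2 ⟨by omega, hx2⟩)
      obtain ⟨i, h1, h2, h3⟩ := exists_eq_of_steps_ge_neg_one (f := g) (c := c)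
        (Nat.sub_le a d) (fun i _ h2 => (hg i (by omega)).2) (by omega) (by omega)
      have hix : a - d < i := lt_of_le_of_ne h1 (by rintro rfl; omega)
      refine ⟨i, fun _ => ⟨h3, by omega, ?_⟩⟩
      by_contra hcon
      obtain ⟨j, j1, j2, j3⟩ := exists_eq_of_steps_le_one (f := f) (c := h) h2
        (fun j _ h2 => (hf j (by omega)).1) (by omega) (by omega)
      exact hmin (a - j) (by omega) ⟨by omega, by rw [Nat.sub_sub_self j2]; exact j3⟩
  obtain ⟨φ, hφ⟩ := key
  have : (Finset.Ico k (2 * k)).card ≤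
      ({s ∈ Finset.range N | h < f s ∧ k ≤ g s} : Finset ℕ).card := by
    refine Finset.card_le_card_of_injOn φ ?_ ?_
    · intro c hc
      obtain ⟨h1, h2, h3⟩ := hφ c hc
      simp only [Finset.coe_filter, Finset.mem_range, Set.mem_ofPred_eq]
      have := Finset.mem_Ico.1 hc
      exact ⟨h2, h3, by omega⟩
    · intro c hc c' hc' hcc
      rw [← (hφ c hc).1, ← (hφ c' hc').1, hcc]
  simp only [Nat.card_Ico] at this
  omega

/-- The half of `exists_visible_level` that concerns one of the two functions. -/
lemma card_estimate {N k : ℕ} {f g : ℕ → ℕ} (hk : 1 ≤ k) (hf : SmallSteps N f)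
    (hg : SmallSteps N g) (hfg : ∀ s < N, 2 * k ≤ f s + g s + 1)
    (hf2 : ∀ h < k, 2 ≤ (levelSet N f h).card) (hg2 : ∀ h < k, 2 ≤ (levelSet N g h).card)
    (hno : ∀ h < k, (levelSet N f h).card = 2 → ∀ x ∈ levelSet N f h, 2 * k ≤ g x) :
    k + 6 * k ≤ ({s ∈ Finset.range N | k ≤ f s ∧ k ≤ g s} : Finset ℕ).card +
      3 * ({s ∈ Finset.range N | f s < k} : Finset ℕ).card := by
  classical
  have hlow : ∀ c a b : ℕ, (∀ x, a ≤ x → x < b → c ≤ (levelSet N f x).card) →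
    c * (b - a) ≤ ({s ∈ Finset.range N | a ≤ f s ∧ f s < b} : Finset ℕ).card :=
    fun c a b h => card_levels_ge h
  by_cases hex : ∃ h, h < k ∧ (levelSet N f h).card = 2
  -- The highest level met exactly twice; all levels between it and `k` are met at least three
  -- times.
  · obtain ⟨h, ⟨hhk, hh2⟩, hmax⟩ : ∃ h, (h < k ∧ (levelSet N f h).card = 2) ∧
        ∀ x, h < x → x < k → 3 ≤ (levelSet N f x).card := by
      let h := Nat.findGreatest (fun h => h < k ∧ (levelSet N f h).card = 2) k
      obtain ⟨h₀, hh₀⟩ := hex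
      refine ⟨h, Nat.findGreatest_spec (P := fun h => h < k ∧ (levelSet N f h).card = 2)
        hh₀.1.le hh₀, ?_⟩
      intro x hx hxk
      have := Nat.findGreatest_is_greatest hx hxk.le
      have h2 := hf2 x hxk
      simp only [hxk, true_and] at this
      omega
    obtain ⟨x₀, hx₀⟩ : (levelSet N f h).Nonempty := Finset.card_pos.1 (by omega)
    obtain ⟨a, ha⟩ : (levelSet N g 0).Nonempty := Finset.card_pos.1 (by have := hg2 0 hk; omega)
    rw [mem_levelSet] at ha
    have e1 := card_above_level_ge (k := k) hf hg ha.1 ha.2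
      (by have := hfg a ha.1; omega) hx₀ (hno h hhk hh2)
    have e2 := hlow 3 (h + 1) k (fun x h1 h2 => hmax x (by omega) h2)
    have e3 := hlow 2 0 (h + 1) (fun x h1 h2 => hf2 x (by omega))
    have e4 : ({s ∈ Finset.range N | h < f s ∧ k ≤ g s} : Finset ℕ).card ≤
        ({s ∈ Finset.range N | k ≤ f s ∧ k ≤ g s} : Finset ℕ).card +
        ({s ∈ Finset.range N | h + 1 ≤ f s ∧ f s < k} : Finset ℕ).card := by
      refine le_trans (Finset.card_le_card ?_) (Finset.card_union_le _ _)
      intro s hs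
      simp only [Finset.mem_filter, Finset.mem_range, Finset.mem_union] at hs ⊢
      omega
    have e5 : ({s ∈ Finset.range N | h + 1 ≤ f s ∧ f s < k} : Finset ℕ).card +
        ({s ∈ Finset.range N | 0 ≤ f s ∧ f s < h + 1} : Finset ℕ).card ≤
        ({s ∈ Finset.range N | f s < k} : Finset ℕ).card := by
      rw [← Finset.card_union_of_disjoint]
      · refine Finset.card_le_card ?_
        intro s hs
        simp only [Finset.mem_filter, Finset.mem_range, Finset.mem_union] at hs ⊢
        omega
      · rw [Finset.disjoint_left]
        intro s hs hs'
        simp only [Finset.mem_filter, Finset.mem_range] at hs hs'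
        omega
    -- With M the count of the middle zone, b that of `h < f < k` and c that of `f ≤ h`: M + b ≥ k,
    -- b ≥ 3(k - h - 1) and c ≥ 2(h + 1). So M + 3(b + c) ≥ (M + b) + 2b + 3c ≥ 7k.
    omega
  · push Not at hex
    have e := hlow 3 0 k (fun x _ h2 => by
      have := hf2 x h2; have := hex x h2; omega)
    have e2 : ({s ∈ Finset.range N | 0 ≤ f s ∧ f s < k} : Finset ℕ) =
      ({s ∈ Finset.range N | f s < k} : Finset ℕ) := by simp
    rw [e2] at e
    omega

/-- Two distance profiles along a path with fewer than `14 k / 3` vertices that both meet all levels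
below `k` at least twice: one of them has a level met exactly twice, at one index of which the other
profile is below `2 k`. -/
lemma exists_visible_level {N k : ℕ} {f g : ℕ → ℕ} (hk : 1 ≤ k) (hN : 3 * N < 14 * k)
    (hf : SmallSteps N f) (hg : SmallSteps N g) (hfg : ∀ s < N, 2 * k ≤ f s + g s + 1)
    (hf2 : ∀ h < k, 2 ≤ (levelSet N f h).card) (hg2 : ∀ h < k, 2 ≤ (levelSet N g h).card) :
    (∃ h < k, (levelSet N f h).card = 2 ∧ ∃ x ∈ levelSet N f h, g x < 2 * k) ∨
    (∃ h < k, (levelSet N g h).card = 2 ∧ ∃ x ∈ levelSet N g h, f x < 2 * k) := by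
  by_contra hcon
  push Not at hcon
  have e1 := card_estimate hk hf hg hfg hf2 hg2 hcon.1
  have e2 := card_estimate hk hg hf (fun s hs => by have := hfg s hs; omega) hg2 hf2 hcon.2
  have e3 : ({s ∈ Finset.range N | k ≤ f s ∧ k ≤ g s} : Finset ℕ).card +
      (({s ∈ Finset.range N | f s < k} : Finset ℕ).card +
      ({s ∈ Finset.range N | g s < k} : Finset ℕ).card) ≤ N := by
    rw [← Finset.card_union_of_disjoint, ← Finset.card_union_of_disjoint]
    · refine (Finset.card_le_card (t := Finset.range N) ?_).trans (by simp)
      intro s hs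
      simp only [Finset.mem_filter, Finset.mem_range, Finset.mem_union] at hs ⊢
      omega
    all_goals
      rw [Finset.disjoint_left]
      intro s hs hs'
      simp only [Finset.mem_filter, Finset.mem_range, Finset.mem_union] at hs hs'
      have := hfg s (by omega)
      omega
  have e4 : ({s ∈ Finset.range N | k ≤ g s ∧ k ≤ f s} : Finset ℕ) =
      ({s ∈ Finset.range N | k ≤ f s ∧ k ≤ g s} : Finset ℕ) := by
    ext s; simp only [Finset.mem_filter]; tauto
  rw [e4] at e2
  -- The two estimates add up to 14k ≤ 2M + 3(F + G), where F and G count the positions below level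
  -- `k`. The right side is at most 3(M + F + G) ≤ 3N.
  omega

/-! ### Bounded distance, classes of large vertices, and table entries. -/

/-- `y` can be reached from `x` by a walk of length at most `n`. -/
def Within {W : Type*} (Γ : SimpleGraph W) : ℕ → W → W → Prop
  | 0, x, y => x = y
  | n + 1, x, y => Within Γ n x y ∨ ∃ z, Within Γ n x z ∧ Γ.Adj z y

namespace Within
variable {W : Type*} {Γ : SimpleGraph W}

lemma refl (n : ℕ) (x : W) : Within Γ n x x := by
  induction n with
  | zero => rfl
  | succ n ih => exact Or.inl ih

lemma mono {m n : ℕ} (h : m ≤ n) {x y : W} (hw : Within Γ m x y) : Within Γ n x y := by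
  induction n, h using Nat.le_induction with
  | base => exact hw
  | succ n _ ih => exact Or.inl ih

lemma step {n : ℕ} {x y z : W} (h : Within Γ n x y) (hyz : Γ.Adj y z) : Within Γ (n + 1) x z :=
  Or.inr ⟨y, h, hyz⟩

lemma trans {m n : ℕ} {x y z : W} (h : Within Γ m x y) (h' : Within Γ n y z) :
    Within Γ (m + n) x z := by
  induction n generalizing z with
  | zero => cases h'; exact h
  | succ n ih =>
    rcases h' with h' | ⟨u, hu, huz⟩
    · exact Or.inl (ih h')
    · exact (ih hu).step huz

lemma of_adj {x y : W} (h : Γ.Adj x y) : Within Γ 1 x y := (refl 0 x).step h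

lemma symm {n : ℕ} {x y : W} (h : Within Γ n x y) : Within Γ n y x := by
  induction n generalizing y with
  | zero => exact Eq.symm h
  | succ n ih =>
    rcases h with h | ⟨u, hu, huy⟩
    · exact Or.inl (ih h)
    · exact ((of_adj huy.symm).trans (ih hu)).mono (by omega)

lemma split {m n : ℕ} {x z : W} (h : Within Γ (m + n) x z) :
    ∃ y, Within Γ m x y ∧ Within Γ n y z := by
  induction n generalizing z with
  | zero => exact ⟨z, h, rfl⟩
  | succ n ih =>
    rcases h with h | ⟨u, hu, huz⟩
    · obtain ⟨y, h1, h2⟩ := ih h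
      exact ⟨y, h1, Or.inl h2⟩
    · obtain ⟨y, h1, h2⟩ := ih hu
      exact ⟨y, h1, h2.step huz⟩

end Within

/-- The vertices of `L` fall into classes: the transitive closure of being at distance at most
`d`. -/
def SameClass {W : Type*} (Γ : SimpleGraph W) (L : Set W) (d : ℕ) (a b : W) : Prop :=
  a ∈ L ∧ b ∈ L ∧ Relation.ReflTransGen (fun a b => a ∈ L ∧ b ∈ L ∧ Within Γ d a b) a b

namespace SameClass
variable {W : Type*} {Γ : SimpleGraph W} {L : Set W} {d : ℕ} {a b c : W}

lemma refl (h : a ∈ L) : SameClass Γ L d a a := ⟨h, h, .refl⟩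

lemma symm (h : SameClass Γ L d a b) : SameClass Γ L d b a := by
  refine ⟨h.2.1, h.1, ?_⟩
  exact Relation.ReflTransGen.mono (fun x y h => ⟨h.2.1, h.1, h.2.2.symm⟩) _ _ h.2.2.swap

lemma trans (h : SameClass Γ L d a b) (h' : SameClass Γ L d b c) : SameClass Γ L d a c :=
  ⟨h.1, h'.2.1, h.2.2.trans h'.2.2⟩

lemma of_within (ha : a ∈ L) (hb : b ∈ L) (h : Within Γ d a b) : SameClass Γ L d a b :=
  ⟨ha, hb, .single ⟨ha, hb, h⟩⟩

end SameClass

/-- `y` is at distance at most `n` from the set `A`. -/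
def Near {W : Type*} (Γ : SimpleGraph W) (A : Set W) (n : ℕ) (y : W) : Prop :=
  ∃ w ∈ A, Within Γ n w y

lemma Near.mono {W : Type*} {Γ : SimpleGraph W} {A : Set W} {m n : ℕ} (h : m ≤ n) {y : W}
    (hy : Near Γ A m y) : Near Γ A n y := by
  obtain ⟨w, hw, h'⟩ := hy
  exact ⟨w, hw, h'.mono h⟩

lemma Near.step {W : Type*} {Γ : SimpleGraph W} {A : Set W} {n : ℕ} {y z : W}
    (hy : Near Γ A n y) (h : Γ.Adj y z) : Near Γ A (n + 1) z := by
  obtain ⟨w, hw, h'⟩ := hy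
  exact ⟨w, hw, h'.step h⟩

/-- The union of the classes that come within distance `r` of `x`. -/
def classOf {W : Type*} (Γ : SimpleGraph W) (L : Set W) (r : ℕ) (x : W) : Set W :=
  {w | ∃ w₀ ∈ L, Within Γ r w₀ x ∧ SameClass Γ L (2 * r) w₀ w}

/-- `p` restricted to the positions in `S` is an induced copy of the part `S` of a path. -/
def IsInducedOn {W : Type*} (Γ : SimpleGraph W) (S : Finset ℕ) (p : ℕ → W) : Prop :=
  ∀ s ∈ S, ∀ t ∈ S, (p s = p t → s = t) ∧ (Γ.Adj (p s) (p t) ↔ s + 1 = t ∨ t + 1 = s)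

/-- The positions in `S` of a path can be realized by vertices of `Γ` so that `x` is at position
`i`, `u` at position `j`, and all others are at distance less than `h` from the class of `x`. -/
def Realizes {W : Type*} (Γ : SimpleGraph W) (L : Set W) (r : ℕ) (x u : W) (h : ℕ)
    (S : Finset ℕ) (i j : ℕ) : Prop :=
  (∃ b, Γ.Adj x b) ∧ (∃ b, Γ.Adj u b) ∧ ∃ ρ : ℕ → W, ρ i = x ∧ ρ j = u ∧
    (∀ s ∈ S, s ≠ i → s ≠ j → ∃ h' < h, Near Γ (classOf Γ L r x) h' (ρ s)) ∧
    IsInducedOn Γ S ρ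

/-! ### Beliefs and the extent to which they are correct. -/

/-- What the vertices near `L` believe about the graph `H`: the vertex `v` believes in `Γ v`. -/
structure Beliefs {W : Type*} (H : SimpleGraph W) (L K : Set W) (r N : ℕ)
    (Γ : W → SimpleGraph W) : Prop where
  closed : ∀ a ∈ K, ∀ b, H.Adj a b → b ∈ K
  low : ∀ v ∈ K, Near H L r v → ∀ a ∈ K, a ∉ L → ∀ b, (Γ v).Adj a b ↔ H.Adj a b
  low_eq : ∀ v ∈ K, Near H L r v → ∀ v' ∈ K, Near H L r v' →
    ∀ a ∉ L, ∀ b, (Γ v).Adj a b ↔ (Γ v').Adj a b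
  row : ∀ w ∈ K, w ∈ L → ∀ b, (Γ w).Adj w b ↔ H.Adj w b
  eq_of_within : ∀ v ∈ K, ∀ w ∈ L, Within H r w v → Γ v = Γ w
  cls : ∀ v ∈ K, Near H L r v → ∀ v' ∈ K, Near H L r v' → ∀ w ∈ L, ∀ w' ∈ L,
    SameClass (Γ v) L (2 * r) w w' ↔ SameClass (Γ v') L (2 * r) w w'
  diag : ∀ v ∈ K, Near H L r v → ∀ v' ∈ K, Near H L r v' →
    ∀ x, ∀ h ≤ r, ∀ S ⊆ Finset.range N, ∀ i < N,
      Realizes (Γ v) L r x x h S i i ↔ Realizes (Γ v') L r x x h S i i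
  priv : ∀ v ∈ K, Near H L r v → ∀ x ∈ K, Near H L r x → Within H (r + 1) v x →
    ∀ u, ∀ h ≤ r, ∀ S ⊆ Finset.range N, ∀ i < N, ∀ j < N,
      Realizes (Γ v) L r x u h S i j ↔ Realizes (Γ x) L r x u h S i j
  free : ∀ v ∈ K, Near H L r v → ¬ ∃ p, IsInducedOn (Γ v) (Finset.range N) p

namespace Beliefs
variable {W : Type*} {H : SimpleGraph W} {L K : Set W} {r N : ℕ} {Γ : W → SimpleGraph W}

lemma near_self {Γ : SimpleGraph W} {A : Set W} {w : W} (n : ℕ) (h : w ∈ A) : Near Γ A n w :=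
  ⟨w, h, Within.refl n w⟩

lemma mem_of_within (B : Beliefs H L K r N Γ) {n : ℕ} {a b : W} (ha : a ∈ K)
    (h : Within H n a b) : b ∈ K := by
  induction n generalizing b with
  | zero => cases h; exact ha
  | succ n ih =>
    rcases h with h | ⟨z, hz, hzb⟩
    · exact ih h
    · exact B.closed z (ih hz) b hzb

/-- The class of `w` shares one belief. -/
lemma eq_of_sameClass (B : Beliefs H L K r N Γ) {w z : W} (hw : w ∈ K)
    (h : SameClass H L (2 * r) w z) : z ∈ K ∧ Γ w = Γ z := by
  obtain ⟨-, -, h⟩ := h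
  induction h with
  | refl => exact ⟨hw, rfl⟩
  | tail _ hbc ih =>
    obtain ⟨hbL, hcL, hbc⟩ := hbc
    obtain ⟨m, h1, h2⟩ := Within.split (m := r) (n := r) (by rwa [two_mul] at hbc)
    have hm := B.mem_of_within ih.1 h1
    refine ⟨B.mem_of_within ih.1 hbc, ?_⟩
    rw [ih.2, ← B.eq_of_within m hm _ hbL h1, B.eq_of_within m hm _ hcL h2.symm]

/-- Rows of small vertices are public. If only `b` is small, its row is common to all beliefs, and
the belief of `a` itself has the right row at `a`. -/
lemma low_adj (B : Beliefs H L K r N Γ) {v a b : W} (hv : v ∈ K) (hE : Near H L r v)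
    (ha : a ∈ K) (h : a ∉ L ∨ b ∉ L) : (Γ v).Adj a b ↔ H.Adj a b := by
  by_cases haL : a ∈ L
  · have hb : b ∉ L := by tauto
    rw [SimpleGraph.adj_comm, B.low_eq v hv hE a ha (near_self r haL) b hb,
      SimpleGraph.adj_comm, B.row a ha haL]
  · exact B.low v hv hE a ha haL b

lemma class_adj (B : Beliefs H L K r N Γ) {w a : W} (hw : w ∈ K)
    (h : SameClass H L (2 * r) w a) (b : W) : (Γ w).Adj a b ↔ H.Adj a b := by
  obtain ⟨haK, he⟩ := B.eq_of_sameClass hw h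
  rw [he, B.row a haK h.2.1]

/-- Large vertices within `2 * r` of `w` belong to its class, so their rows in `Γ w` are right. A
walk of length `2 * r + 1` uses only rows of vertices within `2 * r`. -/
lemma within_iff (B : Beliefs H L K r N Γ) {w : W} (hw : w ∈ K) (hL : w ∈ L) {n : ℕ}
    (hn : n ≤ 2 * r + 1) {z : W} : Within (Γ w) n w z ↔ Within H n w z := by
  induction n generalizing z with
  | zero => rfl
  | succ n ih =>
    have key : ∀ y, Within H n w y → ((Γ w).Adj y z ↔ H.Adj y z) := by
      intro y hy
      have hyK := B.mem_of_within hw hy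
      by_cases hyL : y ∈ L
      · exact B.class_adj hw (.of_within hL hyL (hy.mono (by omega))) z
      · exact B.low_adj hw (near_self r hL) hyK (Or.inl hyL)
    simp only [Within, ih (by omega)]
    refine or_congr Iff.rfl (exists_congr fun y => and_congr_right fun hy => key y hy)

lemma sameClass_self_iff (B : Beliefs H L K r N Γ) {w z : W} (hw : w ∈ K) :
    SameClass (Γ w) L (2 * r) w z ↔ SameClass H L (2 * r) w z := by
  constructor
  · rintro ⟨h1, h2, h⟩
    refine ⟨h1, h2, ?_⟩
    clear h2
    induction h with
    | refl => exact .refl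
    | @tail b c _ hbc ih =>
      obtain ⟨hbL, hcL, hbc⟩ := hbc
      obtain ⟨hbK, he⟩ := B.eq_of_sameClass hw ⟨h1, hbL, ih⟩
      rw [he, B.within_iff hbK hbL (by omega)] at hbc
      exact ih.tail ⟨hbL, hcL, hbc⟩
  · rintro ⟨h1, h2, h⟩
    refine ⟨h1, h2, ?_⟩
    clear h2
    induction h with
    | refl => exact .refl
    | @tail b c hwb hbc ih =>
      obtain ⟨hbL, hcL, hbc⟩ := hbc
      obtain ⟨hbK, he⟩ := B.eq_of_sameClass hw ⟨h1, hbL, hwb⟩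
      rw [← B.within_iff hbK hbL (by omega), ← he] at hbc
      exact ih.tail ⟨hbL, hcL, hbc⟩

/-- All beliefs agree on the partition into classes, and each class is described correctly by the
belief of its own members. -/
lemma sameClass_iff (B : Beliefs H L K r N Γ) {v w z : W} (hv : v ∈ K) (hE : Near H L r v)
    (hw : w ∈ K) : SameClass (Γ v) L (2 * r) w z ↔ SameClass H L (2 * r) w z := by
  by_cases hL : w ∈ L
  swap
  · exact ⟨fun h => absurd h.1 hL, fun h => absurd h.1 hL⟩
  by_cases hz : z ∈ L
  swap
  · exact ⟨fun h => absurd h.2.1 hz, fun h => absurd h.2.1 hz⟩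
  rw [B.cls v hv hE w hw (near_self r hL) w hL z hz, B.sameClass_self_iff hw]

/-- An edge of a belief at a vertex of `K` is an edge of `H` unless both ends are in one class. -/
lemma adj_cases (B : Beliefs H L K r N Γ) (hr : 1 ≤ r) {v a b : W} (hv : v ∈ K)
    (hE : Near H L r v) (ha : a ∈ K) (h : (Γ v).Adj a b) :
    H.Adj a b ∨ SameClass H L (2 * r) a b := by
  by_cases haL : a ∈ L ∧ b ∈ L
  · refine Or.inr ((B.sameClass_iff hv hE ha).1 ?_)
    exact .of_within haL.1 haL.2 ((Within.of_adj h).mono (by omega))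
  · exact Or.inl ((B.low_adj hv hE ha (by tauto)).1 h)

/-- Wrong edges have both ends in one class. A shortest route from a class gains nothing from edges
inside that class, and within `2 * r` of it there are no vertices of other classes. -/
lemma near_iff (B : Beliefs H L K r N Γ) (hr : 1 ≤ r) {v w : W} (hv : v ∈ K) (hE : Near H L r v)
    (hw : w ∈ K) {n : ℕ} (hn : n ≤ 2 * r) {z : W} :
    Near (Γ v) {a | SameClass H L (2 * r) w a} n z ↔
      Near H {a | SameClass H L (2 * r) w a} n z := by
  induction n generalizing z with
  | zero => rfl
  | succ n ih =>
    constructor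
    · rintro ⟨w', hw', h | ⟨y, hy, hyz⟩⟩
      · exact ((ih (by omega)).1 ⟨w', hw', h⟩).mono (by omega)
      · obtain ⟨u, hu, huy⟩ := (ih (by omega)).1 ⟨w', hw', hy⟩
        have hyK := B.mem_of_within (B.eq_of_sameClass hw hu).1 huy
        rcases B.adj_cases hr hv hE hyK hyz with h | h
        · exact ⟨u, hu, huy.step h⟩
        · exact near_self _ (hu.trans
            ((SameClass.of_within hu.2.1 h.1 (huy.mono (by omega))).trans h))
    · rintro ⟨w', hw', h | ⟨y, hy, hyz⟩⟩
      · exact ((ih (by omega)).2 ⟨w', hw', h⟩).mono (by omega)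
      · have hyK := B.mem_of_within (B.eq_of_sameClass hw hw').1 hy
        by_cases hL : y ∈ L ∧ z ∈ L
        · have hwy := hw'.trans (.of_within hw'.2.1 hL.1 (hy.mono (by omega)))
          exact near_self _ (hwy.trans
            (.of_within hL.1 hL.2 ((Within.of_adj hyz).mono (by omega))))
        · exact ((ih (by omega)).2 ⟨w', hw', hy⟩).step
            ((B.low_adj hv hE hyK (by tauto)).2 hyz)

/-- The distance between different classes is more than `2 r`. -/
lemma sameClass_of_near {w w' z : W} {m n : ℕ} (hmn : m + n ≤ 2 * r)
    (h : Near H {a | SameClass H L (2 * r) w a} m z)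
    (h' : Near H {a | SameClass H L (2 * r) w' a} n z) : SameClass H L (2 * r) w w' := by
  obtain ⟨a, ha, haz⟩ := h
  obtain ⟨b, hb, hbz⟩ := h'
  have := SameClass.of_within (d := 2 * r) ha.2.1 hb.2.1 ((haz.trans hbz.symm).mono hmn)
  exact (ha.trans this).trans hb.symm

lemma classOf_eq (B : Beliefs H L K r N Γ) (hr : 1 ≤ r) {v w x : W} (hv : v ∈ K)
    (hE : Near H L r v) (hw : w ∈ K)
    (hx : Near H {a | SameClass H L (2 * r) w a} r x) :
    classOf (Γ v) L r x = {a | SameClass H L (2 * r) w a} := by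
  have hxK : x ∈ K := by
    obtain ⟨a, ha, hax⟩ := hx
    exact B.mem_of_within (B.eq_of_sameClass hw ha).1 hax
  ext a
  constructor
  · rintro ⟨w₀, hw₀, hwx, hc⟩
    have hw₀K : w₀ ∈ K := by
      -- False edges join vertices of one class of `H`, so walks of the belief cannot leave `K`
      -- either.
      have : ∀ n y, Within (Γ v) n x y → y ∈ K := by
        intro n
        induction n with
        | zero => rintro y rfl; exact hxK
        | succ n ih =>
          rintro y (h | ⟨z, hz, hzy⟩)
          · exact ih y h
          · rcases B.adj_cases hr hv hE (ih z hz) hzy with h | h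
            · exact B.closed z (ih z hz) y h
            · exact (B.eq_of_sameClass (ih z hz) h).1
      exact this r w₀ hwx.symm
    have h1 : Near H {a | SameClass H L (2 * r) w₀ a} r x :=
      (B.near_iff hr hv hE hw₀K (by omega)).1 ⟨w₀, SameClass.refl hw₀, hwx⟩
    exact (sameClass_of_near (by omega) hx h1).trans ((B.sameClass_iff hv hE hw₀K).1 hc)
  · intro ha
    obtain ⟨w₀, hw₀, hwx⟩ := (B.near_iff hr hv hE hw (by omega)).2 hx
    refine ⟨w₀, hw₀.2.1, hwx, ?_⟩
    exact (B.sameClass_iff hv hE (B.eq_of_sameClass hw hw₀).1).2 (hw₀.symm.trans ha)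

/-- The part of an induced path of `H` around one class is seen by the vertices near this class. -/
lemma realizes_of_path (B : Beliefs H L K r N Γ) (hr : 1 ≤ r) {p : ℕ → W}
    (hpK : ∀ s < N, p s ∈ K) (hp : IsInducedOn H (Finset.range N) p) (hN : 2 ≤ N)
    {w : W} (hw : w ∈ K) {h : ℕ} (hh : h ≤ r) {S : Finset ℕ} (hS : S ⊆ Finset.range N)
    {i j : ℕ} (hi : i ∈ S) (hj : j ∈ S)
    (hnear : ∀ s ∈ S, Near H {a | SameClass H L (2 * r) w a} h (p s))
    (hin : ∀ s ∈ S, s ≠ i → s ≠ j → ∃ h' < h, Near H {a | SameClass H L (2 * r) w a} h' (p s)) :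
    Realizes (Γ (p i)) L r (p i) (p j) h S i j := by
  have hlt : ∀ s ∈ S, s < N := fun s hs => Finset.mem_range.1 (hS hs)
  have hE : ∀ s ∈ S, Near H L r (p s) := by
    intro s hs
    obtain ⟨a, ha, h'⟩ := hnear s hs
    exact ⟨a, ha.2.1, h'.mono hh⟩
  -- The position `i` lies within `r` of the class and shares its belief. That belief has correct
  -- rows at all positions in `S`, so `p` itself serves as the realization.
  have hΓ : Γ (p i) = Γ w := by
    obtain ⟨a, ha, h'⟩ := hnear i hi
    rw [B.eq_of_within _ (hpK i (hlt i hi)) a ha.2.1 (h'.mono hh), (B.eq_of_sameClass hw ha).2]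
  have hcls : ∀ s ∈ S, p s ∈ L → SameClass H L (2 * r) w (p s) := by
    intro s hs hL
    exact sameClass_of_near (m := h) (n := 0) (by omega) (hnear s hs)
      ⟨p s, SameClass.refl hL, rfl⟩
  have hadj : ∀ s ∈ S, ∀ b, (Γ (p i)).Adj (p s) b ↔ H.Adj (p s) b := by
    intro s hs b
    by_cases hL : p s ∈ L
    · rw [hΓ, B.class_adj hw (hcls s hs hL)]
    · exact B.low_adj (hpK i (hlt i hi)) (hE i hi) (hpK s (hlt s hs)) (Or.inl hL)
  have hdeg : ∀ s ∈ S, ∃ b, (Γ (p i)).Adj (p s) b := by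
    intro s hs
    have hsN := hlt s hs
    by_cases h0 : s = 0
    · exact ⟨p 1, (hadj s hs _).2 ((hp s (hS hs) 1 (by simp; omega)).2.2 (by omega))⟩
    · exact ⟨p (s - 1), (hadj s hs _).2 ((hp s (hS hs) (s - 1) (by simp; omega)).2.2 (by omega))⟩
  have hc := B.classOf_eq hr (hpK i (hlt i hi)) (hE i hi) hw ((hnear i hi).mono hh)
  refine ⟨hdeg i hi, hdeg j hj, p, rfl, rfl, ?_, ?_⟩
  · intro s hs h1 h2
    obtain ⟨h', hlt', hn⟩ := hin s hs h1 h2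
    refine ⟨h', hlt', ?_⟩
    rw [hc, B.near_iff hr (hpK i (hlt i hi)) (hE i hi) hw (by omega)]
    exact hn
  · intro s hs t ht
    rw [hadj s hs]
    exact hp s (hS hs) t (hS ht)

end Beliefs

/-! ### Replacing parts of the path and gluing the replacements. -/

/-- The part of the path `p` within distance `h` of the set `A` can be replaced, in `Γ`, without
moving the vertices at distance exactly `h` and without leaving the neighbourhood. -/
def Replaceable {W : Type*} (H Γ : SimpleGraph W) (A : Set W) (r N : ℕ) (p : ℕ → W) (h : ℕ)
    (ρ : ℕ → W) : Prop :=
  h ≤ r ∧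
  (∀ s < N, Near H A h (p s) → (¬ ∃ h' < h, Near H A h' (p s)) → ρ s = p s) ∧
  (∀ s < N, (∃ h' < h, Near H A h' (p s)) → ∃ h' < h, Near H A h' (ρ s)) ∧
  (∀ s < N, ∀ t < N, Near H A h (p s) → Near H A h (p t) →
    (ρ s = ρ t → s = t) ∧ (Γ.Adj (ρ s) (ρ t) ↔ s + 1 = t ∨ t + 1 = s))

namespace Beliefs
variable {W : Type*} {H : SimpleGraph W} {L K : Set W} {r N : ℕ} {Γ : W → SimpleGraph W}

/-- Simultaneous replacement around several classes. -/
lemma glue (B : Beliefs H L K r N Γ) (hr : 1 ≤ r) {p : ℕ → W} (hpK : ∀ s < N, p s ∈ K)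
    (hp : IsInducedOn H (Finset.range N) p) {v : W} (hv : v ∈ K) (hE : Near H L r v)
    {T : Set (Set W)} {h : Set W → ℕ} {ρ : Set W → ℕ → W}
    (hT : ∀ A ∈ T, ∃ w ∈ K, A = {a | SameClass H L (2 * r) w a})
    (hrep : ∀ A ∈ T, Replaceable H (Γ v) A r N p (h A) (ρ A))
    (hown : ∀ s < N, p s ∈ L → (∀ b, (Γ v).Adj (p s) b ↔ H.Adj (p s) b) ∨ ∃ A ∈ T, p s ∈ A) :
    ∃ p', IsInducedOn (Γ v) (Finset.range N) p' := by
  classical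
  have hsep : ∀ A ∈ T, ∀ A' ∈ T, ∀ m n z, m + n ≤ 2 * r → Near H A m z → Near H A' n z →
      A = A' := by
    intro A hA A' hA' m n z hmn h1 h2
    obtain ⟨w, -, rfl⟩ := hT A hA
    obtain ⟨w', -, rfl⟩ := hT A' hA'
    have := sameClass_of_near hmn h1 h2
    ext a
    exact ⟨fun h => this.symm.trans h, fun h => this.trans h⟩
  have hnear : ∀ A ∈ T, ∀ n ≤ 2 * r, ∀ z, Near (Γ v) A n z ↔ Near H A n z := by
    intro A hA n hn z
    obtain ⟨w, hw, rfl⟩ := hT A hA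
    exact B.near_iff hr hv hE hw hn
  -- Replace strictly inside the neighbourhoods only. These are pairwise disjoint because the radii
  -- are at most `r` and classes are more than `2 * r` apart, so the choice of the class is
  -- unambiguous.
  let p' : ℕ → W := fun s => if hs : ∃ A ∈ T, ∃ h' < h A, Near H A h' (p s) then
    ρ hs.choose s else p s
  have hp'out : ∀ s, (¬ ∃ A ∈ T, ∃ h' < h A, Near H A h' (p s)) → p' s = p s :=
    fun s hs => dif_neg hs
  have hp'in : ∀ s, ∀ A ∈ T, (∃ h' < h A, Near H A h' (p s)) → p' s = ρ A s := by
    intro s A hA hs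
    have hex : ∃ A ∈ T, ∃ h' < h A, Near H A h' (p s) := ⟨A, hA, hs⟩
    have h1 : p' s = ρ hex.choose s := dif_pos hex
    obtain ⟨hmem, h₁, hlt₁, hn₁⟩ := hex.choose_spec
    obtain ⟨h₂, hlt₂, hn₂⟩ := hs
    have e1 := (hrep _ hmem).1
    have e2 := (hrep _ hA).1
    rw [h1, hsep _ hmem _ hA h₁ h₂ (p s) (by omega) hn₁ hn₂]
  have K1 : ∀ s < N, ∀ A ∈ T, Near H A (h A) (p s) → p' s = ρ A s := by
    intro s hs A hA hn
    by_cases hin : ∃ h' < h A, Near H A h' (p s)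
    · exact hp'in s A hA hin
    · rw [(hrep A hA).2.1 s hs hn hin]
      apply hp'out
      rintro ⟨A', hA', h', hlt', hn'⟩
      have e1 := (hrep _ hA).1
      have e2 := (hrep _ hA').1
      have := hsep A hA A' hA' (h A) h' (p s) (by omega) hn hn'
      subst this
      exact hin ⟨h', hlt', hn'⟩
  have K2 : ∀ s < N, ∀ A ∈ T, ¬ Near H A (h A) (p s) → ¬ Near H A (h A) (p' s) := by
    intro s hs A hA hn hn'
    by_cases hin : ∃ A ∈ T, ∃ h' < h A, Near H A h' (p s)
    · obtain ⟨A', hA', hin'⟩ := hin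
      rw [hp'in s A' hA' hin'] at hn'
      obtain ⟨h', hlt', hn''⟩ := (hrep A' hA').2.2.1 s hs hin'
      have e1 := (hrep _ hA).1
      have e2 := (hrep _ hA').1
      have := hsep A hA A' hA' (h A) h' _ (by omega) hn' hn''
      subst this
      obtain ⟨h', hlt', hn''⟩ := hin'
      exact hn (hn''.mono hlt'.le)
    · rw [hp'out s hin] at hn'
      exact hn hn'
  -- A position strictly inside a neighbourhood and one outside its closure are neither equal nor
  -- adjacent, before or after the replacement: one step cannot cross the boundary level.
  have K3 : ∀ s < N, ∀ t < N, ∀ A ∈ T, (∃ h' < h A, Near H A h' (p s)) →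
      ¬ Near H A (h A) (p t) → p' s ≠ p' t ∧ ¬ (Γ v).Adj (p' s) (p' t) ∧
        s ≠ t ∧ ¬ (s + 1 = t ∨ t + 1 = s) := by
    intro s hs t ht A hA hin hn
    obtain ⟨h₁, hlt₁, hn₁⟩ := (hrep A hA).2.2.1 s hs hin
    rw [← hp'in s A hA hin] at hn₁
    have hnt := K2 t ht A hA hn
    have e1 := (hrep _ hA).1
    obtain ⟨h₂, hlt₂, hn₂⟩ := hin
    refine ⟨?_, ?_, ?_, ?_⟩
    · intro heq
      rw [heq] at hn₁
      exact hnt (hn₁.mono hlt₁.le)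
    · intro hadj
      apply hnt
      rw [← hnear A hA _ (by omega)] at hn₁ ⊢
      exact (hn₁.step hadj).mono hlt₁
    · rintro rfl
      exact hn (hn₂.mono hlt₂.le)
    · intro hst
      have := (hp s (by simpa using hs) t (by simpa using ht)).2.2 hst
      exact hn ((hn₂.step this).mono hlt₂)
  refine ⟨p', fun s hs t ht => ?_⟩
  have hpst := hp s hs t ht
  rw [Finset.mem_range] at hs ht
  by_cases c1 : ∃ A ∈ T, Near H A (h A) (p s) ∧ Near H A (h A) (p t)
  · obtain ⟨A, hA, h1, h2⟩ := c1
    rw [K1 s hs A hA h1, K1 t ht A hA h2]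
    exact (hrep A hA).2.2.2 s hs t ht h1 h2
  by_cases c2 : ∃ A ∈ T, ∃ h' < h A, Near H A h' (p s)
  · obtain ⟨A, hA, h1⟩ := c2
    obtain ⟨e1, e2, e3, e4⟩ := K3 s hs t ht A hA h1 (fun h2 => c1 ⟨A, hA, by
      obtain ⟨h', hlt', hn'⟩ := h1
      exact hn'.mono hlt'.le, h2⟩)
    exact ⟨fun h => absurd h e1, fun h => absurd h e2, fun h => absurd h e4⟩
  by_cases c3 : ∃ A ∈ T, ∃ h' < h A, Near H A h' (p t)
  · obtain ⟨A, hA, h1⟩ := c3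
    obtain ⟨e1, e2, e3, e4⟩ := K3 t ht s hs A hA h1 (fun h2 => c1 ⟨A, hA, h2, by
      obtain ⟨h', hlt', hn'⟩ := h1
      exact hn'.mono hlt'.le⟩)
    exact ⟨fun h => absurd h.symm e1, fun h => absurd h.symm e2, fun h => absurd h.symm e4⟩
  rw [hp'out s c2, hp'out t c3]
  refine ⟨hpst.1, ?_⟩
  rw [← hpst.2]
  by_cases hLL : p s ∈ L ∧ p t ∈ L
  swap
  · exact B.low_adj hv hE (hpK s hs) (by tauto)
  rcases hown s hs hLL.1 with h1 | ⟨A, hA, hsA⟩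
  · exact h1 _
  rcases hown t ht hLL.2 with h1 | -
  · rw [SimpleGraph.adj_comm, h1, SimpleGraph.adj_comm]
  -- The only edges on which the belief could err join two large vertices of one foreign class, and
  -- that case has been settled inside a single neighbourhood.
  have hno : ¬ SameClass H L (2 * r) (p s) (p t) := by
    intro hc
    refine c1 ⟨A, hA, near_self _ hsA, near_self _ ?_⟩
    obtain ⟨w, -, rfl⟩ := hT A hA
    exact SameClass.trans hsA hc
  constructor
  · intro hadj
    exact (B.adj_cases hr hv hE (hpK s hs) hadj).resolve_right hno
  · intro hadj
    exact absurd (.of_within hLL.1 hLL.2 ((Within.of_adj hadj).mono (by omega))) hno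

/-! ### Distance profiles of a path and their table entries. -/

/-- The profile of distances to `A` along `p`. -/
noncomputable def profile (H : SimpleGraph W) (A : Set W) (p : ℕ → W) (s : ℕ) : ℕ :=
  sInf {n | Near H A n (p s)}

lemma path_within {p : ℕ → W} (hp : IsInducedOn H (Finset.range N) p) {s : ℕ} (d : ℕ)
    (hs : s + d < N) : Within H d (p s) (p (s + d)) := by
  induction d with
  | zero => exact rfl
  | succ d ih =>
    refine (ih (by omega)).step ((hp (s + d) (by simp; omega) _ (by simp; omega)).2.2 ?_)
    omega

/-- The path itself connects `p s` to a point of `A`, so the infimum is over a nonempty set and is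
attained. -/
lemma near_iff_profile {p : ℕ → W} (hp : IsInducedOn H (Finset.range N) p) {A : Set W} {s₀ s : ℕ}
    (hs₀ : s₀ < N) (hA : p s₀ ∈ A) (hs : s < N) {n : ℕ} :
    Near H A n (p s) ↔ profile H A p s ≤ n := by
  have hne : {n | Near H A n (p s)}.Nonempty := by
    rcases le_total s₀ s with h | h
    · refine ⟨s - s₀, p s₀, hA, ?_⟩
      have := path_within hp (s := s₀) (s - s₀) (by omega)
      rwa [Nat.add_sub_cancel' h] at this
    · refine ⟨s₀ - s, p s₀, hA, ?_⟩
      have := path_within hp (s := s) (s₀ - s) (by omega)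
      rw [Nat.add_sub_cancel' h] at this
      exact this.symm
  constructor
  · intro h
    exact Nat.sInf_le h
  · intro h
    exact (Nat.sInf_mem hne : Near H A _ (p s)).mono h

lemma smallSteps_profile {p : ℕ → W} (hp : IsInducedOn H (Finset.range N) p) {A : Set W} {s₀ : ℕ}
    (hs₀ : s₀ < N) (hA : p s₀ ∈ A) : SmallSteps N (profile H A p) := by
  intro i hi
  have hadj : H.Adj (p i) (p (i + 1)) :=
    (hp i (by simp; omega) (i + 1) (by simpa using hi)).2.2 (Or.inl rfl)
  constructor
  · rw [← near_iff_profile hp hs₀ hA hi]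
    exact ((near_iff_profile hp hs₀ hA (by omega)).2 le_rfl).step hadj
  · rw [← near_iff_profile hp hs₀ hA (by omega)]
    exact ((near_iff_profile hp hs₀ hA hi).2 le_rfl).step hadj.symm

/-- If `p` meets the level `h` only at the positions `i` and `j`, a table entry allows to replace the
part of `p` below this level. -/
lemma replaceable_of_realizes (B : Beliefs H L K r N Γ) (hr : 1 ≤ r) {p : ℕ → W}
    (hp : IsInducedOn H (Finset.range N) p)
    {v w : W} (hv : v ∈ K) (hE : Near H L r v) (hw : w ∈ K) {h i j s₀ : ℕ} (hh : h ≤ r)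
    (hs₀ : s₀ < N) (hA : SameClass H L (2 * r) w (p s₀)) (hi : i < N)
    (hlev : levelSet N (profile H {a | SameClass H L (2 * r) w a} p) h = {i, j})
    (hR : Realizes (Γ v) L r (p i) (p j) h
      {s ∈ Finset.range N | profile H {a | SameClass H L (2 * r) w a} p s ≤ h} i j) :
    ∃ h ρ, Replaceable H (Γ v) {a | SameClass H L (2 * r) w a} r N p h ρ := by
  have hprof : ∀ {s}, s < N → ∀ {n}, Near H {a | SameClass H L (2 * r) w a} n (p s) ↔
      profile H {a | SameClass H L (2 * r) w a} p s ≤ n :=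
    fun hs _ => near_iff_profile hp hs₀ hA hs
  obtain ⟨-, -, ρ, hρi, hρj, hρin, hρ⟩ := hR
  have hmem : ∀ s, s ∈ levelSet N (profile H {a | SameClass H L (2 * r) w a} p) h ↔
      s = i ∨ s = j := by
    intro s; rw [hlev]; simp
  have hpi := (mem_levelSet.1 ((hmem i).2 (Or.inl rfl))).2
  have hc := B.classOf_eq hr hv hE hw (((hprof hi).2 hpi.le).mono hh)
  have hinner : ∀ s < N, (∃ h' < h, Near H {a | SameClass H L (2 * r) w a} h' (p s)) →
      profile H {a | SameClass H L (2 * r) w a} p s < h := by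
    rintro s hs ⟨h', hlt, hn⟩
    exact ((hprof hs).1 hn).trans_lt hlt
  refine ⟨h, ρ, hh, ?_, ?_, ?_⟩
  · intro s hs h1 h2
    have h3 := (hprof hs).1 h1
    have h4 : profile H {a | SameClass H L (2 * r) w a} p s = h := by
      refine le_antisymm h3 ?_
      by_contra hlt
      exact h2 ⟨_, not_le.1 hlt, (hprof hs).2 le_rfl⟩
    rcases (hmem s).1 (mem_levelSet.2 ⟨hs, h4⟩) with rfl | rfl
    · exact hρi
    · exact hρj
  · intro s hs hin
    have hlt := hinner s hs hin
    have hns : ¬ (s = i ∨ s = j) := by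
      rw [← hmem, mem_levelSet]
      omega
    obtain ⟨h', hlt', hn⟩ := hρin s (by simp [hs, hlt.le]) (by tauto) (by tauto)
    refine ⟨h', hlt', ?_⟩
    rwa [hc, B.near_iff hr hv hE hw (by omega)] at hn
  · intro s hs t ht h1 h2
    exact hρ s (by simp [hs, (hprof hs).1 h1]) t (by simp [ht, (hprof ht).1 h2])

/-- The true path is its own witness for the table entry at `p i`, because positions other than `i`
and `j` lie strictly below the level. -/
lemma realizes_at_level (B : Beliefs H L K r N Γ) (hr : 1 ≤ r) {p : ℕ → W}
    (hpK : ∀ s < N, p s ∈ K) (hp : IsInducedOn H (Finset.range N) p) (hN : 2 ≤ N)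
    {w : W} (hw : w ∈ K) {h i j s₀ : ℕ} (hh : h ≤ r)
    (hs₀ : s₀ < N) (hA : SameClass H L (2 * r) w (p s₀))
    (hlev : levelSet N (profile H {a | SameClass H L (2 * r) w a} p) h = {i, j}) :
    Realizes (Γ (p i)) L r (p i) (p j) h
      {s ∈ Finset.range N | profile H {a | SameClass H L (2 * r) w a} p s ≤ h} i j := by
  have hprof : ∀ {s}, s < N → ∀ {n}, Near H {a | SameClass H L (2 * r) w a} n (p s) ↔
      profile H {a | SameClass H L (2 * r) w a} p s ≤ n :=
    fun hs _ => near_iff_profile hp hs₀ hA hs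
  have hmem : ∀ s, s ∈ levelSet N (profile H {a | SameClass H L (2 * r) w a} p) h ↔
      s = i ∨ s = j := by
    intro s; rw [hlev]; simp
  have hi := mem_levelSet.1 ((hmem i).2 (Or.inl rfl))
  have hj := mem_levelSet.1 ((hmem j).2 (Or.inr rfl))
  refine B.realizes_of_path hr hpK hp hN hw hh (Finset.filter_subset _ _)
    (by simp [hi]) (by simp [hj]) ?_ ?_
  · intro s hs
    simp only [Finset.mem_filter, Finset.mem_range] at hs
    exact (hprof hs.1).2 hs.2
  · intro s hs h1 h2
    simp only [Finset.mem_filter, Finset.mem_range] at hs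
    refine ⟨_, lt_of_le_of_ne hs.2 ?_, (hprof hs.1).2 le_rfl⟩
    intro heq
    have := (hmem s).1 (mem_levelSet.2 ⟨hs.1, heq⟩)
    tauto

end Beliefs

/-! ### Refuting an induced path that meets a large vertex. -/

namespace Beliefs
variable {W : Type*} {H : SimpleGraph W} {L K : Set W} {r N : ℕ} {Γ : W → SimpleGraph W}

/-- A vertex that can replace what it does not know refutes the existence of the path. -/
lemma false_of_replaceable (B : Beliefs H L K r N Γ) (hr : 1 ≤ r) {p : ℕ → W}
    (hpK : ∀ s < N, p s ∈ K) (hp : IsInducedOn H (Finset.range N) p) {v w : W} (hv : v ∈ K)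
    (hw : w ∈ L) (hvw : Within H r w v)
    (h : ∀ s < N, p s ∈ L → ¬ SameClass H L (2 * r) w (p s) →
      ∃ h ρ, Replaceable H (Γ v) {a | SameClass H L (2 * r) (p s) a} r N p h ρ) : False := by
  classical
  have hE : Near H L r v := ⟨w, hw, hvw⟩
  have hwK : w ∈ K := B.mem_of_within hv hvw.symm
  let T : Set (Set W) := {A | ∃ s < N, p s ∈ L ∧ ¬ SameClass H L (2 * r) w (p s) ∧
    A = {a | SameClass H L (2 * r) (p s) a}}
  have hT : ∀ A, ∃ (h : ℕ) (ρ : ℕ → W), A ∈ T → Replaceable H (Γ v) A r N p h ρ := by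
    intro A
    by_cases hA : A ∈ T
    · obtain ⟨s, hs, hsL, hno, rfl⟩ := hA
      obtain ⟨h', ρ, hρ⟩ := h s hs hsL hno
      exact ⟨h', ρ, fun _ => hρ⟩
    · exact ⟨0, p, fun h => absurd h hA⟩
  choose hh ρ hρ using hT
  refine B.free v hv hE (B.glue hr hpK hp hv hE (T := T) (h := hh) (ρ := ρ) ?_ hρ ?_)
  · rintro A ⟨s, hs, -, -, rfl⟩
    exact ⟨p s, hpK s hs, rfl⟩
  · intro s hs hsL
    by_cases hc : SameClass H L (2 * r) w (p s)
    · left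
      intro b
      rw [B.eq_of_within v hv w hw hvw]
      exact B.class_adj hwK hc b
    · right
      exact ⟨_, ⟨s, hs, hsL, hc, rfl⟩, SameClass.refl hsL⟩

lemma profile_self {p : ℕ → W} {s : ℕ} (hs : p s ∈ L) :
    profile H {a | SameClass H L (2 * r) (p s) a} p s = 0 :=
  Nat.le_zero.1 (Nat.sInf_le (near_self 0 (SameClass.refl hs)))

/-- The path meets all levels up to `r` around each of its classes: otherwise it would stay close to
one class, and the belief of this class would contain it. -/
lemma levelSet_nonempty (B : Beliefs H L K r N Γ) (hr : 1 ≤ r) {p : ℕ → W}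
    (hpK : ∀ s < N, p s ∈ K) (hp : IsInducedOn H (Finset.range N) p) {s₀ h : ℕ} (hs₀ : s₀ < N)
    (hL : p s₀ ∈ L) (hh : h ≤ r) :
    (levelSet N (profile H {a | SameClass H L (2 * r) (p s₀) a} p) h).Nonempty := by
  by_contra hne
  rw [Finset.not_nonempty_iff_eq_empty] at hne
  have hsteps := smallSteps_profile hp hs₀ (A := {a | SameClass H L (2 * r) (p s₀) a})
    (SameClass.refl hL)
  have h0 := profile_self (H := H) (r := r) hL
  -- A path missing level `h` stays below it by the intermediate value property, so it meets no
  -- other class and nothing has to be replaced.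
  refine B.false_of_replaceable hr hpK hp (hpK s₀ hs₀) hL (Within.refl r _) ?_
  intro s hs hsL hno
  exfalso
  have hlt : profile H {a | SameClass H L (2 * r) (p s₀) a} p s ≤ h := by
    by_contra hgt
    have : ∃ i < N, profile H {a | SameClass H L (2 * r) (p s₀) a} p i = h := by
      rcases le_total s₀ s with hle | hle
      · obtain ⟨i, h1, h2, h3⟩ := exists_eq_of_steps_le_one (c := h) hle
          (fun i _ h2 => (hsteps i (by omega)).1) (by omega) (by omega)
        exact ⟨i, by omega, h3⟩
      · obtain ⟨i, h1, h2, h3⟩ := exists_eq_of_steps_ge_neg_one (c := h) hle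
          (fun i _ h2 => (hsteps i (by omega)).2) (by omega) (by omega)
        exact ⟨i, by omega, h3⟩
    obtain ⟨i, hi, hi2⟩ := this
    have : i ∈ levelSet N (profile H {a | SameClass H L (2 * r) (p s₀) a} p) h :=
      mem_levelSet.2 ⟨hi, hi2⟩
    rw [hne] at this
    simp at this
  have hn := (near_iff_profile hp hs₀ (A := {a | SameClass H L (2 * r) (p s₀) a})
    (SameClass.refl hL) hs).2 hlt
  exact hno (sameClass_of_near (n := 0) (by omega) hn ⟨p s, SameClass.refl hsL, rfl⟩)

/-- With a single boundary position the relevant entry has equal end positions and belongs to the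
global table. So any `v` near `L` may use it, however far away the class is. -/
lemma replaceable_of_card_eq_one (B : Beliefs H L K r N Γ) (hr : 1 ≤ r) {p : ℕ → W}
    (hpK : ∀ s < N, p s ∈ K) (hp : IsInducedOn H (Finset.range N) p) (hN : 2 ≤ N)
    {v : W} (hv : v ∈ K) (hE : Near H L r v) {s₀ h : ℕ} (hs₀ : s₀ < N)
    (hL : p s₀ ∈ L) (hh : h ≤ r)
    (hcard : (levelSet N (profile H {a | SameClass H L (2 * r) (p s₀) a} p) h).card = 1) :
    ∃ h ρ, Replaceable H (Γ v) {a | SameClass H L (2 * r) (p s₀) a} r N p h ρ := by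
  obtain ⟨i, hi⟩ := Finset.card_eq_one.1 hcard
  have hi' := mem_levelSet.1 (hi ▸ Finset.mem_singleton_self i)
  have hpair : levelSet N (profile H {a | SameClass H L (2 * r) (p s₀) a} p) h = {i, i} := by
    simpa using hi
  have hn := (near_iff_profile hp hs₀ (A := {a | SameClass H L (2 * r) (p s₀) a})
    (SameClass.refl hL) hi'.1).2 hi'.2.le
  have hEi : Near H L r (p i) := by
    obtain ⟨a, ha, h'⟩ := hn
    exact ⟨a, ha.2.1, h'.mono hh⟩
  have hR := B.realizes_at_level hr hpK hp hN (hpK s₀ hs₀) hh hs₀ (SameClass.refl hL) hpair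
  refine B.replaceable_of_realizes hr hp hv hE (hpK s₀ hs₀) hh hs₀ (SameClass.refl hL) hi'.1
    hpair ?_
  exact (B.diag _ (hpK i hi'.1) hEi v hv hE (p i) h hh _ (Finset.filter_subset _ _) i hi'.1).1 hR

/-- With two boundary positions the entry is in the private table of `p i`, which `v` can consult
only if `p i` is within `r + 1`. -/
lemma replaceable_of_card_eq_two (B : Beliefs H L K r N Γ) (hr : 1 ≤ r) {p : ℕ → W}
    (hpK : ∀ s < N, p s ∈ K) (hp : IsInducedOn H (Finset.range N) p) (hN : 2 ≤ N)
    {v : W} (hv : v ∈ K) (hE : Near H L r v) {s₀ h i : ℕ} (hs₀ : s₀ < N)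
    (hL : p s₀ ∈ L) (hh : h ≤ r)
    (hcard : (levelSet N (profile H {a | SameClass H L (2 * r) (p s₀) a} p) h).card = 2)
    (hi : i ∈ levelSet N (profile H {a | SameClass H L (2 * r) (p s₀) a} p) h)
    (hvi : Within H (r + 1) v (p i)) :
    ∃ h ρ, Replaceable H (Γ v) {a | SameClass H L (2 * r) (p s₀) a} r N p h ρ := by
  obtain ⟨j, hij⟩ : ∃ j, levelSet N (profile H {a | SameClass H L (2 * r) (p s₀) a} p) h =
      {i, j} := by
    obtain ⟨x, y, -, hxy⟩ := Finset.card_eq_two.1 hcard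
    rw [hxy] at hi ⊢
    simp only [Finset.mem_insert, Finset.mem_singleton] at hi
    rcases hi with rfl | rfl
    · exact ⟨y, rfl⟩
    · exact ⟨x, Finset.pair_comm _ _⟩
  have hj : j ∈ levelSet N (profile H {a | SameClass H L (2 * r) (p s₀) a} p) h := by
    rw [hij]; simp
  have hi' := mem_levelSet.1 hi
  have hn := (near_iff_profile hp hs₀ (A := {a | SameClass H L (2 * r) (p s₀) a})
    (SameClass.refl hL) hi'.1).2 hi'.2.le
  have hEi : Near H L r (p i) := by
    obtain ⟨a, ha, h'⟩ := hn
    exact ⟨a, ha.2.1, h'.mono hh⟩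
  have hR := B.realizes_at_level hr hpK hp hN (hpK s₀ hs₀) hh hs₀ (SameClass.refl hL) hij
  refine B.replaceable_of_realizes hr hp hv hE (hpK s₀ hs₀) hh hs₀ (SameClass.refl hL) hi'.1
    hij ?_
  exact (B.priv v hv hE (p i) (hpK i hi'.1) hEi hvi (p j) h hh _
    (Finset.filter_subset _ _) i hi'.1 j (mem_levelSet.1 hj).1).2 hR

/-- All levels up to `r` around the class of `p s` are met at least twice. -/
def Hard (H : SimpleGraph W) (L : Set W) (r N : ℕ) (p : ℕ → W) (s : ℕ) : Prop :=
  ∀ h ≤ r, 2 ≤ (levelSet N (profile H {a | SameClass H L (2 * r) (p s) a} p) h).card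

lemma replaceable_of_not_hard (B : Beliefs H L K r N Γ) (hr : 1 ≤ r) {p : ℕ → W}
    (hpK : ∀ s < N, p s ∈ K) (hp : IsInducedOn H (Finset.range N) p) (hN : 2 ≤ N)
    {v : W} (hv : v ∈ K) (hE : Near H L r v) {s₀ : ℕ} (hs₀ : s₀ < N)
    (hL : p s₀ ∈ L) (hhard : ¬ Hard H L r N p s₀) :
    ∃ h ρ, Replaceable H (Γ v) {a | SameClass H L (2 * r) (p s₀) a} r N p h ρ := by
  simp only [Hard, not_forall, not_le] at hhard
  obtain ⟨h, hh, hlt⟩ := hhard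
  have := Finset.card_pos.2 (B.levelSet_nonempty hr hpK hp hs₀ hL hh)
  exact B.replaceable_of_card_eq_one hr hpK hp hN hv hE hs₀ hL hh (by omega)

lemma profile_add_ge {p : ℕ → W} (hp : IsInducedOn H (Finset.range N) p) {s₁ s₂ s : ℕ}
    (h₁ : s₁ < N) (h₂ : s₂ < N) (hL₁ : p s₁ ∈ L) (hL₂ : p s₂ ∈ L)
    (hno : ¬ SameClass H L (2 * r) (p s₁) (p s₂)) (hs : s < N) :
    2 * (r + 1) ≤ profile H {a | SameClass H L (2 * r) (p s₁) a} p s +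
      profile H {a | SameClass H L (2 * r) (p s₂) a} p s + 1 := by
  by_contra hlt
  exact hno (sameClass_of_near (m := profile H {a | SameClass H L (2 * r) (p s₁) a} p s)
    (n := profile H {a | SameClass H L (2 * r) (p s₂) a} p s) (by omega)
    ((near_iff_profile hp h₁ (SameClass.refl hL₁) hs).2 le_rfl)
    ((near_iff_profile hp h₂ (SameClass.refl hL₂) hs).2 le_rfl))

/-- A hard class claims at least `2 * (r + 1)` positions within `r` of it, and these sets are
disjoint for different classes; three of them need 6(r + 1) > N positions. -/
lemma not_three_hard {p : ℕ → W} (hp : IsInducedOn H (Finset.range N) p)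
    (hN : 3 * N < 14 * (r + 1)) {s₁ s₂ s₃ : ℕ} (h₁ : s₁ < N) (h₂ : s₂ < N) (h₃ : s₃ < N)
    (hL₁ : p s₁ ∈ L) (hL₂ : p s₂ ∈ L) (hL₃ : p s₃ ∈ L)
    (h12 : ¬ SameClass H L (2 * r) (p s₁) (p s₂)) (h13 : ¬ SameClass H L (2 * r) (p s₁) (p s₃))
    (h23 : ¬ SameClass H L (2 * r) (p s₂) (p s₃))
    (hh₁ : Hard H L r N p s₁) (hh₂ : Hard H L r N p s₂) (hh₃ : Hard H L r N p s₃) : False := by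
  have key : ∀ s, Hard H L r N p s → 2 * (r + 1) ≤ ({t ∈ Finset.range N | 0 ≤
      profile H {a | SameClass H L (2 * r) (p s) a} p t ∧
      profile H {a | SameClass H L (2 * r) (p s) a} p t < r + 1} : Finset ℕ).card :=
    fun s hs => card_levels_ge (a := 0) (b := r + 1) (fun x _ hx => hs x (by omega))
  have e1 := key s₁ hh₁
  have e2 := key s₂ hh₂
  have e3 := key s₃ hh₃
  have hle : ({t ∈ Finset.range N | 0 ≤
      profile H {a | SameClass H L (2 * r) (p s₁) a} p t ∧
      profile H {a | SameClass H L (2 * r) (p s₁) a} p t < r + 1} : Finset ℕ).card +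
      (({t ∈ Finset.range N | 0 ≤
      profile H {a | SameClass H L (2 * r) (p s₂) a} p t ∧
      profile H {a | SameClass H L (2 * r) (p s₂) a} p t < r + 1} : Finset ℕ).card +
      ({t ∈ Finset.range N | 0 ≤
      profile H {a | SameClass H L (2 * r) (p s₃) a} p t ∧
      profile H {a | SameClass H L (2 * r) (p s₃) a} p t < r + 1} : Finset ℕ).card) ≤ N := by
    rw [← Finset.card_union_of_disjoint, ← Finset.card_union_of_disjoint]
    · refine (Finset.card_le_card (t := Finset.range N) ?_).trans (by simp)
      intro s hs
      simp only [Finset.mem_filter, Finset.mem_range, Finset.mem_union] at hs ⊢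
      tauto
    all_goals
      rw [Finset.disjoint_left]
      intro s hs hs'
      simp only [Finset.mem_filter, Finset.mem_range, Finset.mem_union] at hs hs'
      have e12 := profile_add_ge hp h₁ h₂ hL₁ hL₂ h12 (s := s) (by tauto)
      have e13 := profile_add_ge hp h₁ h₃ hL₁ hL₃ h13 (s := s) (by tauto)
      have e23 := profile_add_ge hp h₂ h₃ hL₂ hL₃ h23 (s := s) (by tauto)
      omega
  omega

/-- The case of two hard classes, the second of which has a suitable level. -/
lemma false_of_visible (B : Beliefs H L K r N Γ) (hr : 1 ≤ r) {p : ℕ → W}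
    (hpK : ∀ s < N, p s ∈ K) (hp : IsInducedOn H (Finset.range N) p) (hN2 : 2 ≤ N)
    (hN : 3 * N < 14 * (r + 1)) {s₁ s₂ h x : ℕ} (h₁ : s₁ < N) (h₂ : s₂ < N)
    (hL₁ : p s₁ ∈ L) (hL₂ : p s₂ ∈ L) (h12 : ¬ SameClass H L (2 * r) (p s₁) (p s₂))
    (hh₁ : Hard H L r N p s₁) (hh₂ : Hard H L r N p s₂) (hh : h ≤ r)
    (hcard : (levelSet N (profile H {a | SameClass H L (2 * r) (p s₂) a} p) h).card = 2)
    (hx : x ∈ levelSet N (profile H {a | SameClass H L (2 * r) (p s₂) a} p) h)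
    (hvis : profile H {a | SameClass H L (2 * r) (p s₁) a} p x < 2 * (r + 1)) : False := by
  have hxN := (mem_levelSet.1 hx).1
  -- Distance at most `2 * r + 1` splits as `r` plus `r + 1`. The vertex `v` at the split shares the
  -- belief of the first class and still sees `p x`.
  have hnear := (near_iff_profile hp h₁ (A := {a | SameClass H L (2 * r) (p s₁) a})
    (SameClass.refl hL₁) hxN (n := r + (r + 1))).2 (by omega)
  obtain ⟨w, hw, hwx⟩ := hnear
  obtain ⟨v, hwv, hvx⟩ := hwx.split
  have hwK := (B.eq_of_sameClass (hpK s₁ h₁) hw).1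
  have hv := B.mem_of_within hwK hwv
  have hE : Near H L r v := ⟨w, hw.2.1, hwv⟩
  refine B.false_of_replaceable hr hpK hp hv hw.2.1 hwv ?_
  intro s hs hsL hno
  have h1s : ¬ SameClass H L (2 * r) (p s₁) (p s) := fun h' => hno (SameClass.symm hw |>.trans h')
  by_cases h2s : SameClass H L (2 * r) (p s₂) (p s)
  · have heq : {a | SameClass H L (2 * r) (p s) a} = {a | SameClass H L (2 * r) (p s₂) a} := by
      ext a
      exact ⟨fun h => h2s.trans h, fun h => h2s.symm.trans h⟩
    rw [heq]
    exact B.replaceable_of_card_eq_two hr hpK hp hN2 hv hE h₂ hL₂ hh hcard hx hvx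
  · refine B.replaceable_of_not_hard hr hpK hp hN2 hv hE hs hsL ?_
    intro hhs
    exact not_three_hard hp hN h₁ h₂ hs hL₁ hL₂ hsL h12 h1s h2s hh₁ hh₂ hhs

/-- Consistent beliefs exclude an induced path that meets `L`. -/
theorem no_path (B : Beliefs H L K r N Γ) (hr : 1 ≤ r) {p : ℕ → W}
    (hpK : ∀ s < N, p s ∈ K) (hp : IsInducedOn H (Finset.range N) p) (hN2 : 2 ≤ N)
    (hN : 3 * N < 14 * (r + 1)) {s₀ : ℕ} (hs₀ : s₀ < N) (hL₀ : p s₀ ∈ L) : False := by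
  by_cases hone : ∃ s₁ < N, p s₁ ∈ L ∧ ∀ s < N, p s ∈ L →
      ¬ SameClass H L (2 * r) (p s₁) (p s) → ¬ Hard H L r N p s
  · obtain ⟨s₁, h₁, hL₁, hs⟩ := hone
    refine B.false_of_replaceable hr hpK hp (hpK s₁ h₁) hL₁ (Within.refl r _) ?_
    intro s hsN hsL hno
    exact B.replaceable_of_not_hard hr hpK hp hN2 (hpK s₁ h₁) (near_self r hL₁) hsN hsL
      (hs s hsN hsL hno)
  · push Not at hone
    obtain ⟨s₁, h₁, hL₁, -, hh₁⟩ := hone s₀ hs₀ hL₀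
    obtain ⟨s₂, h₂, hL₂, h12, hh₂⟩ := hone s₁ h₁ hL₁
    rcases exists_visible_level (k := r + 1) (by omega) hN
      (smallSteps_profile hp h₁ (A := {a | SameClass H L (2 * r) (p s₁) a}) (SameClass.refl hL₁))
      (smallSteps_profile hp h₂ (A := {a | SameClass H L (2 * r) (p s₂) a}) (SameClass.refl hL₂))
      (fun s hs => profile_add_ge hp h₁ h₂ hL₁ hL₂ h12 hs)
      (fun h hh => hh₁ h (by omega)) (fun h hh => hh₂ h (by omega)) with
      ⟨h, hh, hcard, x, hx, hvis⟩ | ⟨h, hh, hcard, x, hx, hvis⟩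
    · exact B.false_of_visible hr hpK hp hN2 hN h₂ h₁ hL₂ hL₁ (fun h => h12 h.symm) hh₂ hh₁
        (by omega) hcard hx hvis
    · exact B.false_of_visible hr hpK hp hN2 hN h₁ h₂ hL₁ hL₂ h12 hh₁ hh₂
        (by omega) hcard hx hvis

end Beliefs

/-! ### Finite sets of numbers as bit strings. -/

/-- A self-delimiting code for bit strings. -/
def encodeBits : List Bool → List Bool
  | [] => [false]
  | b :: l => true :: b :: encodeBits l

lemma encodeBits_append_inj : ∀ {l l' m m' : List Bool},
    encodeBits l ++ m = encodeBits l' ++ m' → l = l' ∧ m = m'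
  | [], [], _, _, h => by simpa [encodeBits] using h
  | [], _ :: _, _, _, h => by simp [encodeBits] at h
  | _ :: _, [], _, _, h => by simp [encodeBits] at h
  | b :: l, b' :: l', m, m', h => by
    simp only [encodeBits, List.cons_append, List.cons.injEq, true_and] at h
    obtain ⟨h1, h2⟩ := encodeBits_append_inj h.2
    exact ⟨by rw [h.1, h1], h2⟩

lemma length_encodeBits (l : List Bool) : (encodeBits l).length = 2 * l.length + 1 := by
  induction l with
  | nil => rfl
  | cons b l ih => simp only [encodeBits, List.length_cons, ih]; omega

lemma Nat.bits_injective : Function.Injective Nat.bits := by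
  have h : ∀ n : ℕ, n.bits.foldr Nat.bit 0 = n := by
    intro n
    induction n using Nat.binaryRec' with
    | zero => simp
    | bit b n h ih => rw [Nat.bits_append_bit _ _ h, List.foldr_cons, ih]
  exact Function.LeftInverse.injective (g := fun l : List Bool => l.foldr Nat.bit 0) h

def encodeList : List ℕ → List Bool
  | [] => []
  | x :: l => encodeBits x.bits ++ encodeList l

lemma encodeList_injective : Function.Injective encodeList := by
  have hne : ∀ (x : ℕ) (l : List ℕ), encodeList (x :: l) ≠ [] := by
    intro x l h
    have := congrArg List.length h
    simp [encodeList, length_encodeBits] at this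
  intro l
  induction l with
  | nil =>
    rintro (- | ⟨x, l'⟩) h
    · rfl
    · exact absurd h.symm (hne x l')
  | cons x l ih =>
    rintro (- | ⟨x', l'⟩) h
    · exact absurd h (hne x l)
    · obtain ⟨h1, h2⟩ := encodeBits_append_inj h
      rw [Nat.bits_injective h1, ih h2]

lemma length_encodeList_le {l : List ℕ} {B : ℕ} (h : ∀ x ∈ l, x.size ≤ B) :
    (encodeList l).length ≤ l.length * (2 * B + 1) := by
  induction l with
  | nil => simp [encodeList]
  | cons x l ih =>
    have h1 := ih fun y hy => h y (List.mem_cons_of_mem _ hy)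
    have h2 := h x List.mem_cons_self
    simp only [encodeList, List.length_append, length_encodeBits, Nat.size_eq_bits_len,
      List.length_cons]
    nlinarith

/-- A finite set of natural numbers as a bit string. -/
noncomputable def encodeCert (F : Finset ℕ) : List Bool := encodeList F.toList

lemma encodeCert_injective : Function.Injective encodeCert := by
  intro F F' h
  have := encodeList_injective h
  rw [← F.toList_toFinset, ← F'.toList_toFinset, this]

lemma length_encodeCert_le {F : Finset ℕ} {B : ℕ} (h : ∀ x ∈ F, x.size ≤ B) :
    (encodeCert F).length ≤ F.card * (2 * B + 1) := by
  rw [← F.length_toList]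
  exact length_encodeList_le (by simpa using h)

noncomputable def decodeCert : List Bool → Finset ℕ := Function.invFun encodeCert

lemma decodeCert_encodeCert (F : Finset ℕ) : decodeCert (encodeCert F) = F :=
  Function.leftInverse_invFun encodeCert_injective F

/-! ### Colourings that distribute the adjacency rows. -/

lemma two_mul_pred_pow_le {q : ℕ} (hq : 1 ≤ q) : 2 * (q - 1) ^ q ≤ q ^ q := by
  obtain ⟨m, rfl⟩ : ∃ m, q = m + 1 := ⟨q - 1, by omega⟩
  -- Bernoulli's inequality (1 + 1/m)^k ≥ 1 + k/m without denominators; k = m + 1 makes the right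
  -- side exceed 2.
  have h : ∀ k, m ^ k * (m + k) ≤ m * (m + 1) ^ k := by
    intro k
    induction k with
    | zero => simp
    | succ k ih =>
      calc m ^ (k + 1) * (m + (k + 1)) ≤ m ^ k * (m + k) * (m + 1) := by
            rw [pow_succ]; nlinarith [Nat.zero_le (m ^ k * k)]
        _ ≤ m * (m + 1) ^ k * (m + 1) := Nat.mul_le_mul_right _ ih
        _ = m * (m + 1) ^ (k + 1) := by ring
  rcases Nat.eq_zero_or_pos m with rfl | hm
  · simp
  refine Nat.le_of_mul_le_mul_left ?_ hm
  refine le_trans ?_ (h (m + 1))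
  rw [Nat.add_sub_cancel]
  nlinarith [Nat.zero_le (m ^ (m + 1))]

/-- A colouring by `q` colours under which each of the large sets `𝒩 w` meets every colour. -/
lemma exists_coloring {V : Type*} [Fintype V] [DecidableEq V] (𝒩 : V → Finset V) (q t : ℕ)
    (hq : 1 ≤ q) (ht : Fintype.card V * q < 2 ^ t) :
    ∃ κ : V → Fin q, ∀ w, q * t ≤ (𝒩 w).card → ∀ i, ∃ u ∈ 𝒩 w, κ u = i := by
  classical
  set n := Fintype.card V with hn
  let bad : V × Fin q → Finset (V → Fin q) := fun x =>
    if q * t ≤ (𝒩 x.1).card then ({κ | ∀ u ∈ 𝒩 x.1, κ u ≠ x.2} : Finset (V → Fin q)) else ∅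
  -- Union bound by counting: a fixed colour is missed on `q * t` vertices by a fraction (1 -
  -- 1/q)^{qt} ≤ 2^{-t} of all colourings, and there are `n * q` pairs of a vertex and a colour.
  have hbad : ∀ x, (bad x).card * 2 ^ t ≤ q ^ n := by
    rintro ⟨w, i⟩
    by_cases hw : q * t ≤ (𝒩 w).card
    swap
    · simp [bad, hw]
    obtain ⟨A, hA, hAc⟩ := Finset.exists_subset_card_eq hw
    have hsub : bad (w, i) ⊆ Fintype.piFinset fun u => if u ∈ A then {i}ᶜ else Finset.univ := by
      intro κ hκ
      simp only [bad, hw, if_true, Finset.mem_filter, Finset.mem_univ, true_and] at hκ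
      rw [Fintype.mem_piFinset]
      intro u
      by_cases hu : u ∈ A
      · simpa [hu] using hκ u (hA hu)
      · simp [hu]
    have hcard := Finset.card_le_card hsub
    rw [Fintype.card_piFinset] at hcard
    have hprod : ∏ u : V, (if u ∈ A then ({i}ᶜ : Finset (Fin q)) else Finset.univ).card =
        (q - 1) ^ (q * t) * q ^ (n - q * t) := by
      have : ∀ u : V, (if u ∈ A then ({i}ᶜ : Finset (Fin q)) else Finset.univ).card =
          if u ∈ A then q - 1 else q := by
        intro u
        split_ifs
        · simp [Finset.card_compl]
        · simp
      simp only [this]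
      rw [Finset.prod_ite]
      simp only [Finset.prod_const]
      congr 2
      · simp [hAc]
      · rw [← hAc, hn, ← Finset.card_compl]
        congr 1
        ext; simp
    rw [hprod] at hcard
    have hle : q * t ≤ n := by
      rw [← hAc]; exact Finset.card_le_univ A
    have h2 : (q - 1) ^ (q * t) * 2 ^ t ≤ q ^ (q * t) := by
      rw [pow_mul, pow_mul, ← mul_pow, mul_comm]
      exact Nat.pow_le_pow_left (two_mul_pred_pow_le hq) t
    calc (bad (w, i)).card * 2 ^ t ≤ (q - 1) ^ (q * t) * q ^ (n - q * t) * 2 ^ t :=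
          Nat.mul_le_mul_right _ hcard
      _ = ((q - 1) ^ (q * t) * 2 ^ t) * q ^ (n - q * t) := by ring
      _ ≤ q ^ (q * t) * q ^ (n - q * t) := Nat.mul_le_mul_right _ h2
      _ = q ^ n := by rw [← pow_add, Nat.add_sub_cancel' hle]
  have hunion : (Finset.univ.biUnion bad).card < Fintype.card (V → Fin q) := by
    rw [Fintype.card_fun, Fintype.card_fin, ← hn]
    have h1 : (Finset.univ.biUnion bad).card * 2 ^ t ≤ (n * q) * q ^ n := by
      calc (Finset.univ.biUnion bad).card * 2 ^ t ≤ (∑ x, (bad x).card) * 2 ^ t :=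
            Nat.mul_le_mul_right _ Finset.card_biUnion_le
        _ = ∑ x, (bad x).card * 2 ^ t := Finset.sum_mul _ _ _
        _ ≤ ∑ _x : V × Fin q, q ^ n := Finset.sum_le_sum fun x _ => hbad x
        _ = (n * q) * q ^ n := by simp [hn]
    have h2 : (n * q) * q ^ n < 2 ^ t * q ^ n :=
      Nat.mul_lt_mul_of_pos_right ht (Nat.pow_pos hq)
    by_contra hcon
    have := Nat.mul_le_mul_right (2 ^ t) (not_lt.1 hcon)
    rw [mul_comm (q ^ n)] at this
    omega
  obtain ⟨κ, hκ⟩ : ∃ κ, κ ∉ Finset.univ.biUnion bad := by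
    by_contra hcon
    push Not at hcon
    rw [Finset.eq_univ_iff_forall.2 hcon, Finset.card_univ] at hunion
    exact lt_irrefl _ hunion
  refine ⟨κ, fun w hw i => ?_⟩
  by_contra hcon
  push Not at hcon
  refine hκ (Finset.mem_biUnion.2 ⟨(w, i), Finset.mem_univ _, ?_⟩)
  simp only [bad, hw, if_true, Finset.mem_filter, Finset.mem_univ, true_and]
  exact hcon

/-- A balanced colouring. -/
lemma exists_balanced {V : Type*} [Fintype V] (q : ℕ) (hq : 1 ≤ q) :
    ∃ κ : V → Fin q, ∀ i, ({z | κ z = i} : Finset V).card ≤ Fintype.card V / q + 1 := by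
  let e := Fintype.equivFin V
  refine ⟨fun z => ⟨(e z : ℕ) % q, Nat.mod_lt _ hq⟩, fun i => ?_⟩
  rw [← Finset.card_range (Fintype.card V / q + 1)]
  refine Finset.card_le_card_of_injOn (fun z => (e z : ℕ) / q) ?_ ?_
  · intro z _
    simp only [Finset.coe_range, Set.mem_Iio]
    exact Nat.lt_succ_of_le (Nat.div_le_div_right (e z).2.le)
  · intro z hz z' hz' h
    simp only [Finset.coe_filter, Finset.mem_univ, true_and, Set.mem_ofPred_eq] at hz hz'
    have h1 : (e z : ℕ) % q = (e z' : ℕ) % q := by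
      rw [← hz'] at hz
      exact congrArg Fin.val hz
    have h2 : (e z : ℕ) / q = (e z' : ℕ) / q := h
    refine e.injective (Fin.ext ?_)
    rw [← Nat.div_add_mod (e z : ℕ) q, h1, h2, Nat.div_add_mod]

/-! ### Growth of the certificate size. -/

/-- The size of the certificates. -/
def certSize (c C D n : ℕ) : ℕ :=
  (n * ((Nat.sqrt n + 1) * (2 * n.size)) + n + n + n * C + n * C + (n / (Nat.sqrt n + 1) + 1) +
    (n / (Nat.sqrt n + 1) + 1) * n) * (2 * (4 * (n ^ c + D + 7).size) + 1)

lemma size_le_mul_log {n : ℕ} (hn : 2 ≤ n) : (n.size : ℝ) ≤ 2 / Real.log 2 * Real.log n := by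
  have hlog2 : 0 < Real.log 2 := Real.log_pos (by norm_num)
  have h1 : 2 ^ (n.size - 1) ≤ n := Nat.lt_size.1 (by
    have := Nat.size_pos.2 (show 0 < n by omega); omega)
  have h2 : ((n.size - 1 : ℕ) : ℝ) * Real.log 2 ≤ Real.log n := by
    rw [← Real.log_pow]
    exact Real.log_le_log (by positivity) (by exact_mod_cast h1)
  have h3 : 2 ≤ n.size := Nat.lt_size.2 (by simpa using hn)
  have h4 : (n.size : ℝ) ≤ 2 * ((n.size - 1 : ℕ) : ℝ) := by
    rw [Nat.cast_sub (by omega)]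
    have : (2 : ℝ) ≤ n.size := by exact_mod_cast h3
    push_cast; linarith
  rw [div_mul_eq_mul_div, le_div_iff₀ hlog2]
  nlinarith

lemma certSize_isBigO (c C D : ℕ) : (fun n : ℕ => (certSize c C D n : ℝ)) =O[atTop]
    (fun n : ℕ => (n : ℝ) ^ (3 / 2 : ℝ) * Real.log (n : ℝ) ^ 2) := by
  set E := (D + 7).size + 1 with hE
  have key : ∀ n : ℕ, 2 ≤ n → (certSize c C D n : ℝ) ≤
      ((10 + 2 * C) * (8 * (c + E) + 1)) * ((n : ℝ) * Real.sqrt n * (n.size : ℝ) ^ 2) := by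
    intro n hn
    set b := n.size with hb
    have hb1 : 1 ≤ b := Nat.size_pos.2 (by omega)
    have hM : (n ^ c + D + 7).size ≤ (c + E) * b := by
      have h1 : (n ^ c + D + 7).size ≤ c * b + E := by
        rw [Nat.size_le]
        have h2 : n ^ c ≤ 2 ^ (c * b) := by
          rw [mul_comm, pow_mul]
          exact Nat.pow_le_pow_left (Nat.lt_size_self n).le c
        have h3 : D + 7 < 2 ^ (D + 7).size := Nat.lt_size_self _
        have h4 : 1 ≤ 2 ^ (c * b) := Nat.one_le_two_pow
        have h5 : 2 ^ (c * b + E) = 2 * (2 ^ (c * b) * 2 ^ (D + 7).size) := by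
          rw [hE]; ring
        rw [h5]
        nlinarith [Nat.mul_le_mul h4 h3.le, Nat.mul_le_mul_left (2 ^ (c * b)) (show 1 ≤ 2 ^ (D + 7).size by omega)]
      nlinarith
    set x := Real.sqrt n with hx
    have hnR : (2 : ℝ) ≤ n := by exact_mod_cast hn
    have hx1 : 1 ≤ x := by rw [hx, Real.one_le_sqrt]; linarith
    have hxx : x * x = n := Real.mul_self_sqrt (by positivity)
    have hq1 : ((Nat.sqrt n + 1 : ℕ) : ℝ) ≤ 2 * x := by
      have : (Nat.sqrt n : ℝ) ≤ x := Real.nat_sqrt_le_real_sqrt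
      push_cast; linarith
    have hq2 : x ≤ ((Nat.sqrt n + 1 : ℕ) : ℝ) := by
      push_cast; exact Real.real_sqrt_le_nat_sqrt_succ
    have hy : ((n / (Nat.sqrt n + 1) + 1 : ℕ) : ℝ) ≤ 2 * x := by
      have h1 : ((n / (Nat.sqrt n + 1) : ℕ) : ℝ) ≤ n / ((Nat.sqrt n + 1 : ℕ) : ℝ) :=
        Nat.cast_div_le
      have h2 : (n : ℝ) / ((Nat.sqrt n + 1 : ℕ) : ℝ) ≤ x := by
        rw [div_le_iff₀ (by linarith)]
        nlinarith
      push_cast at h1 h2 ⊢; linarith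
    have hbR : (1 : ℝ) ≤ b := by exact_mod_cast hb1
    have hMR : ((n ^ c + D + 7).size : ℝ) ≤ (c + E) * b := by exact_mod_cast hM
    have hcE : (0 : ℝ) ≤ (c : ℝ) + E := by positivity
    have hC : (0 : ℝ) ≤ C := by positivity
    have e1 : (n : ℝ) ≤ n * x * b := by
      have : (1 : ℝ) ≤ x * b := by nlinarith
      nlinarith
    have f1 : ((n * ((Nat.sqrt n + 1) * (2 * b)) + n + n + n * C + n * C +
        (n / (Nat.sqrt n + 1) + 1) + (n / (Nat.sqrt n + 1) + 1) * n : ℕ) : ℝ) ≤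
        (10 + 2 * C) * (n * x * b) := by
      rw [Nat.cast_add, Nat.cast_add, Nat.cast_add, Nat.cast_add, Nat.cast_add, Nat.cast_add]
      rw [Nat.cast_mul, Nat.cast_mul (Nat.sqrt n + 1), Nat.cast_mul n C,
        Nat.cast_mul (n / (Nat.sqrt n + 1) + 1) n]
      have g1 : (n : ℝ) * (((Nat.sqrt n + 1 : ℕ) : ℝ) * ((2 * b : ℕ) : ℝ)) ≤ 4 * (n * x * b) := by
        push_cast at hq1 ⊢
        have : ((Nat.sqrt n : ℝ) + 1) * (2 * b) ≤ 2 * x * (2 * b) := by gcongr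
        nlinarith
      have g2 : (n : ℝ) * C ≤ C * (n * x * b) := by nlinarith
      have g3 : ((n / (Nat.sqrt n + 1) + 1 : ℕ) : ℝ) * n ≤ 2 * (n * x * b) := by
        have : ((n / (Nat.sqrt n + 1) + 1 : ℕ) : ℝ) * n ≤ 2 * x * n := by gcongr
        have : x * n ≤ x * n * b := by nlinarith [mul_pos (show 0 < x by linarith) (show (0:ℝ) < n by linarith)]
        nlinarith
      have g4 : ((n / (Nat.sqrt n + 1) + 1 : ℕ) : ℝ) ≤ 2 * (n * x * b) := by
        have : ((n / (Nat.sqrt n + 1) + 1 : ℕ) : ℝ) ≤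
          ((n / (Nat.sqrt n + 1) + 1 : ℕ) : ℝ) * n := by
          have : (0 : ℝ) ≤ ((n / (Nat.sqrt n + 1) + 1 : ℕ) : ℝ) := by positivity
          nlinarith
        linarith
      nlinarith
    have f2 : ((2 * (4 * (n ^ c + D + 7).size) + 1 : ℕ) : ℝ) ≤ (8 * (c + E) + 1) * b := by
      push_cast
      nlinarith
    rw [certSize, Nat.cast_mul]
    calc _ ≤ ((10 + 2 * C) * (n * x * b)) * ((8 * (c + E) + 1) * b) := by
          gcongr
      _ = _ := by ring
  refine IsBigO.of_bound (((10 + 2 * C) * (8 * (c + E) + 1)) * (2 / Real.log 2) ^ 2) ?_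
  filter_upwards [eventually_ge_atTop 2] with n hn
  have h1 := key n hn
  have hnR : (0 : ℝ) < n := by exact_mod_cast (show 0 < n by omega)
  have h2 : (n : ℝ) ^ (3 / 2 : ℝ) = n * Real.sqrt n := by
    rw [Real.sqrt_eq_rpow, show (3 / 2 : ℝ) = 1 + 1 / 2 by norm_num, Real.rpow_add hnR,
      Real.rpow_one]
  have h3 := size_le_mul_log hn
  have h4 : (n.size : ℝ) ^ 2 ≤ (2 / Real.log 2) ^ 2 * Real.log n ^ 2 := by
    rw [← mul_pow]
    exact pow_le_pow_left₀ (by positivity) h3 2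
  rw [Real.norm_of_nonneg (by positivity), Real.norm_of_nonneg (by positivity), h2]
  refine h1.trans ?_
  calc _ ≤ ((10 + 2 * C) * (8 * (c + E) + 1)) * ((n : ℝ) * Real.sqrt n *
        ((2 / Real.log 2) ^ 2 * Real.log n ^ 2)) := by gcongr
    _ = _ := by ring

/-! ### The verification algorithm and its soundness. -/

/-- A piece of information with the tag `t` about `a` and `b`. -/
def fact (t a b : ℕ) : ℕ := Nat.pair t (Nat.pair a b)

lemma fact_inj {t a b t' a' b' : ℕ} :
    fact t a b = fact t' a' b' ↔ t = t' ∧ a = a' ∧ b = b' := by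
  simp [fact, Nat.pair_eq_pair]

/-- The code of a table index. -/
def patternCode (h : ℕ) (S : Finset ℕ) (i j : ℕ) : ℕ := Encodable.encode (h, S, i, j)

lemma patternCode_inj {h i j h' i' j' : ℕ} {S S' : Finset ℕ} :
    patternCode h S i j = patternCode h' S' i' j' ↔ h = h' ∧ S = S' ∧ i = i' ∧ j = j' := by
  simp [patternCode, Encodable.encode_inj]

/-- The vertices that the facts `F` declare to have a large degree. -/
def bigSet (F : Set ℕ) : Set ℕ := {w | fact 1 w 0 ∈ F}

/-- The graph `Γ` agrees with everything that the vertex `c` of `H` can read from the facts `Φ`. -/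
structure Plausible (H : SimpleGraph ℕ) (Φ : ℕ → Set ℕ) (r N c : ℕ) (Γ : SimpleGraph ℕ) :
    Prop where
  -- Neighbours of a large `w` within `r` are within `r + 1`, hence visible; together they must
  -- supply the row of every large vertex.
  holds : ∀ w, Within H r c w → w ∈ bigSet (Φ c) → ∀ z ∈ bigSet (Φ c),
    ∃ u, (u = w ∨ H.Adj w u) ∧ fact 5 z 0 ∈ Φ u
  rows : ∀ w, Within H r c w → w ∈ bigSet (Φ c) → ∀ z ∈ bigSet (Φ c),
    ∀ u, (u = w ∨ H.Adj w u) → fact 5 z 0 ∈ Φ u → ∀ b, fact 6 z b ∈ Φ u ↔ Γ.Adj z b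
  low : ∀ a ∉ bigSet (Φ c), ∀ b, fact 0 a b ∈ Φ c ↔ Γ.Adj a b
  cls : ∀ w ∈ bigSet (Φ c), ∀ w' ∈ bigSet (Φ c), SameClass Γ (bigSet (Φ c)) (2 * r) w w' ↔
    ∃ l, fact 2 w l ∈ Φ c ∧ fact 2 w' l ∈ Φ c
  diag : ∀ x, ∀ h ≤ r, ∀ S ⊆ Finset.range N, ∀ i < N,
    fact 3 x (patternCode h S i i) ∈ Φ c ↔ Realizes Γ (bigSet (Φ c)) r x x h S i i
  priv : ∀ x, Within H (r + 1) c x → ∀ u, ∀ h ≤ r, ∀ S ⊆ Finset.range N, ∀ i < N, ∀ j < N,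
    fact 4 u (patternCode h S i j) ∈ Φ x ↔ Realizes Γ (bigSet (Φ c)) r x u h S i j
  own : c ∈ bigSet (Φ c) → ∀ b, Γ.Adj c b ↔ H.Adj c b
  free : ¬ ∃ p, IsInducedOn Γ (Finset.range N) p

/-- The edges whose both ends have a small degree according to the facts `F`. -/
def lowGraph (F : Set ℕ) : SimpleGraph ℕ where
  Adj a b := a ≠ b ∧ fact 0 a b ∈ F ∧ fact 0 b a ∈ F
  symm := ⟨fun _ _ h => ⟨h.1.symm, h.2.2, h.2.1⟩⟩
  loopless := ⟨fun _ h => h.1 rfl⟩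

/-- The verification at the vertex `c`. -/
structure Accepts (H : SimpleGraph ℕ) (Φ : ℕ → Set ℕ) (r N c : ℕ) : Prop where
  global : ∀ u, H.Adj c u → ∀ t ≤ 3, ∀ a b, fact t a b ∈ Φ u ↔ fact t a b ∈ Φ c
  low : c ∉ bigSet (Φ c) → ∀ b, fact 0 c b ∈ Φ c ↔ H.Adj c b
  free : ¬ ∃ p, (∀ s < N, p s ∉ bigSet (Φ c)) ∧
    IsInducedOn (lowGraph (Φ c)) (Finset.range N) p
  plausible : (∃ w ∈ bigSet (Φ c), Within H r c w) → ∃ Γ, Plausible H Φ r N c Γ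

/-- The verification depends only on the vicinity of `c`. -/
lemma Accepts.congr {H H' : SimpleGraph ℕ} {Φ Φ' : ℕ → Set ℕ} {r N c : ℕ}
    (hw : ∀ n ≤ r + 1, ∀ a, Within H n c a ↔ Within H' n c a)
    (hadj : ∀ a, Within H r c a → ∀ b, H.Adj a b ↔ H'.Adj a b)
    (hΦ : ∀ a, Within H (r + 1) c a → Φ a = Φ' a) (h : Accepts H Φ r N c) :
    Accepts H' Φ' r N c := by
  have hc := hΦ c (Within.refl _ c)
  have hΦ' : ∀ w, Within H r c w → ∀ u, (u = w ∨ H'.Adj w u) → Φ u = Φ' u := by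
    rintro w hw' u (rfl | hu)
    · exact hΦ _ (hw'.mono (by omega))
    · exact hΦ _ (hw'.step ((hadj w hw' u).2 hu))
  refine ⟨?_, ?_, ?_, ?_⟩
  · intro u hu
    rw [← hc, ← hΦ' c (Within.refl _ c) u (Or.inr hu)]
    exact h.global u ((hadj c (Within.refl _ c) u).2 hu)
  · rw [← hc]
    intro hcL b
    rw [← hadj c (Within.refl _ c)]
    exact h.low hcL b
  · rw [← hc]
    exact h.free
  · rintro ⟨w, hwL, hwr⟩
    rw [← hc] at hwL
    obtain ⟨Γ, hΓ⟩ := h.plausible ⟨w, hwL, (hw r (by omega) w).2 hwr⟩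
    refine ⟨Γ, ?_, ?_, ?_, ?_, ?_, ?_, ?_, hΓ.free⟩
    · intro w hwr hwL z hz
      rw [← hw r (by omega)] at hwr
      rw [← hc] at hwL hz
      obtain ⟨u, hu, hf⟩ := hΓ.holds w hwr hwL z hz
      rw [hadj w hwr] at hu
      exact ⟨u, hu, hΦ' w hwr u hu ▸ hf⟩
    · intro w hwr hwL z hz u hu hf b
      rw [← hw r (by omega)] at hwr
      rw [← hc] at hwL hz
      rw [← hΦ' w hwr u hu] at hf ⊢
      rw [← hadj w hwr] at hu
      exact hΓ.rows w hwr hwL z hz u hu hf b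
    · rw [← hc]; exact hΓ.low
    · rw [← hc]; exact hΓ.cls
    · rw [← hc]; exact hΓ.diag
    · rw [← hc]
      intro x hx
      rw [← hw _ le_rfl] at hx
      rw [← hΦ x hx]
      exact hΓ.priv x hx
    · rw [← hc]
      intro hcL b
      rw [← hadj c (Within.refl _ c)]
      exact hΓ.own hcL b

/-- If all vertices accept, there is no induced path on `N` vertices. -/
theorem not_path_of_accepts {H : SimpleGraph ℕ} {Φ : ℕ → Set ℕ} {r N : ℕ} (hr : 1 ≤ r)
    (hN2 : 2 ≤ N) (hN : 3 * N < 14 * (r + 1))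
    (hacc : ∀ c, (∃ b, H.Adj c b) → Accepts H Φ r N c) :
    ¬ ∃ p, IsInducedOn H (Finset.range N) p := by
  classical
  rintro ⟨p, hp⟩
  have hp01 : H.Adj (p 0) (p 1) :=
    (hp 0 (by simp; omega) 1 (by simp; omega)).2.2 (Or.inl rfl)
  -- The component of the path. Each of its members has a neighbour, so `hacc` applies to it, and
  -- facts with tag at most 3 are constant on it.
  let K : Set ℕ := {a | ∃ n, Within H n (p 0) a}
  have hpK : ∀ s < N, p s ∈ K := fun s hs =>
    ⟨s, by simpa using Beliefs.path_within hp (s := 0) s (by omega)⟩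
  have hclosed : ∀ a ∈ K, ∀ b, H.Adj a b → b ∈ K := by
    rintro a ⟨n, hn⟩ b hab
    exact ⟨n + 1, hn.step hab⟩
  have haccK : ∀ a ∈ K, Accepts H Φ r N a := by
    rintro a ⟨n, hn⟩
    apply hacc
    induction n with
    | zero => cases hn; exact ⟨_, hp01⟩
    | succ n ih =>
      rcases hn with hn | ⟨z, -, hz⟩
      · exact ih hn
      · exact ⟨z, hz.symm⟩
  have hglob : ∀ a ∈ K, ∀ t ≤ 3, ∀ x y, fact t x y ∈ Φ a ↔ fact t x y ∈ Φ (p 0) := by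
    rintro a ⟨n, hn⟩ t ht x y
    induction n generalizing a with
    | zero => cases hn; rfl
    | succ n ih =>
      rcases hn with hn | ⟨z, hz, hza⟩
      · exact ih a hn
      · rw [(haccK z ⟨n, hz⟩).global a hza t ht, ih z hz]
  set L := bigSet (Φ (p 0)) with hL
  have hbig : ∀ a ∈ K, bigSet (Φ a) = L := by
    intro a ha
    ext w
    exact hglob a ha 1 (by omega) w 0
  have hp0K : p 0 ∈ K := hpK 0 (by omega)
  by_cases hLp : ∃ s < N, p s ∈ L
  swap
  · push Not at hLp
    refine (haccK _ hp0K).free ⟨p, hLp, fun s hs t ht => ⟨(hp s hs t ht).1, ?_⟩⟩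
    rw [← (hp s hs t ht).2]
    rw [Finset.mem_range] at hs ht
    have h1 : ∀ s < N, ∀ b, fact 0 (p s) b ∈ Φ (p 0) ↔ H.Adj (p s) b := by
      intro s hs b
      rw [← hglob (p s) (hpK s hs) 0 (by omega)]
      exact (haccK _ (hpK s hs)).low (by rw [hbig _ (hpK s hs)]; exact hLp s hs) b
    change _ ∧ _ ∧ _ ↔ _
    rw [h1 s hs, h1 t ht]
    exact ⟨fun h => h.2.1, fun h => ⟨h.ne, h, h.symm⟩⟩
  obtain ⟨s₀, hs₀, hs₀L⟩ := hLp
  have hΓ : ∀ v, ∃ Γ, v ∈ K → Near H L r v → Plausible H Φ r N v Γ := by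
    intro v
    by_cases hv : v ∈ K ∧ Near H L r v
    · obtain ⟨hv, w, hw, hwv⟩ := hv
      obtain ⟨Γ, h⟩ := (haccK v hv).plausible ⟨w, by rwa [hbig v hv], hwv.symm⟩
      exact ⟨Γ, fun _ _ => h⟩
    · exact ⟨⊥, fun h1 h2 => absurd ⟨h1, h2⟩ hv⟩
  choose Γ hΓ using hΓ
  have hlow : ∀ v ∈ K, Near H L r v → ∀ a ∉ L, ∀ b,
      (Γ v).Adj a b ↔ fact 0 a b ∈ Φ (p 0) := by
    intro v hv hE a ha b
    rw [← (hΓ v hv hE).low a (by rwa [hbig v hv]) b]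
    exact hglob v hv 0 (by omega) a b
  have hmem : ∀ {n a b}, a ∈ K → Within H n a b → b ∈ K := by
    rintro n a b ⟨m, hm⟩ h
    exact ⟨_, hm.trans h⟩
  have B : Beliefs H L K r N Γ := by
    refine ⟨hclosed, ?_, ?_, ?_, ?_, ?_, ?_, ?_, ?_⟩
    · intro v hv hE a ha haL b
      rw [hlow v hv hE a haL, ← hglob a ha 0 (by omega)]
      exact (haccK a ha).low (by rwa [hbig a ha]) b
    · intro v hv hE v' hv' hE' a ha b
      rw [hlow v hv hE a ha, hlow v' hv' hE' a ha]
    · intro w hw hwL b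
      exact (hΓ w hw (Beliefs.near_self r hwL)).own (by rwa [hbig w hw]) b
    · intro v hv w hwL hwv
      have hE : Near H L r v := ⟨w, hwL, hwv⟩
      have hwK := hmem hv hwv.symm
      have hE' : Near H L r w := Beliefs.near_self r hwL
      ext a b
      by_cases ha : a ∈ L
      swap
      · rw [hlow v hv hE a ha, hlow w hwK hE' a ha]
      -- Some `u` in the closed neighbourhood of `w` declares the row of `a`. Both `v` and `w` read
      -- it there, so their beliefs agree.
      obtain ⟨u, hu, hf⟩ := (hΓ v hv hE).holds w hwv.symm (by rwa [hbig v hv]) a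
        (by rwa [hbig v hv])
      rw [← (hΓ v hv hE).rows w hwv.symm (by rwa [hbig v hv]) a (by rwa [hbig v hv]) u hu hf b,
        ← (hΓ w hwK hE').rows w (Within.refl r w) (by rwa [hbig w hwK]) a
          (by rwa [hbig w hwK]) u hu hf b]
    · intro v hv hE v' hv' hE' w hw w' hw'
      have h1 := (hΓ v hv hE).cls w (by rwa [hbig v hv]) w' (by rwa [hbig v hv])
      have h2 := (hΓ v' hv' hE').cls w (by rwa [hbig v' hv']) w' (by rwa [hbig v' hv'])
      rw [hbig v hv] at h1
      rw [hbig v' hv'] at h2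
      rw [h1, h2]
      simp only [hglob v hv 2 (by omega), hglob v' hv' 2 (by omega)]
    · intro v hv hE v' hv' hE' x h hh S hS i hi
      have h1 := (hΓ v hv hE).diag x h hh S hS i hi
      have h2 := (hΓ v' hv' hE').diag x h hh S hS i hi
      rw [hbig v hv] at h1
      rw [hbig v' hv'] at h2
      rw [← h1, ← h2, hglob v hv 3 le_rfl, hglob v' hv' 3 le_rfl]
    · intro v hv hE x hx hEx hvx u h hh S hS i hi j hj
      have h1 := (hΓ v hv hE).priv x hvx u h hh S hS i hi j hj
      have h2 := (hΓ x hx hEx).priv x (Within.refl _ x) u h hh S hS i hi j hj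
      rw [hbig v hv] at h1
      rw [hbig x hx] at h2
      rw [← h1, ← h2]
    · exact fun v hv hE => (hΓ v hv hE).free
  exact B.no_path hr hpK hp hN2 hN hs₀ hs₀L

/-! ### From views to the verification algorithm. -/

lemma within_iff_edist_le {V : Type*} {G : SimpleGraph V} {n : ℕ} {v u : V} :
    Within G n v u ↔ G.edist v u ≤ n := by
  constructor
  · intro h
    induction n generalizing u with
    | zero => cases h; simp
    | succ n ih =>
      rcases h with h | ⟨z, hz, hzu⟩
      · exact (ih h).trans (by exact_mod_cast Nat.le_succ n)
      · calc G.edist v u ≤ G.edist v z + G.edist z u := SimpleGraph.edist_triangle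
          _ ≤ n + 1 := add_le_add (ih hz) (SimpleGraph.edist_eq_one_iff_adj.2 hzu).le
          _ = _ := by push_cast; rfl
  · intro h
    have hreach : G.Reachable v u := by
      rw [← SimpleGraph.edist_ne_top_iff_reachable]
      exact ne_top_of_le_ne_top (ENat.natCast_ne_top n) h
    obtain ⟨p, hp⟩ := hreach.exists_walk_length_eq_edist
    rw [← hp] at h
    have hlen : p.length ≤ n := by exact_mod_cast h
    have key : ∀ {a b : V} (p : G.Walk a b), Within G p.length a b := by
      intro a b p
      induction p with
      | nil => exact rfl
      | cons h p ih =>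
        rw [SimpleGraph.Walk.length_cons, add_comm]
        exact (Within.of_adj h).trans ih
    exact (key p).mono hlen

/-- The graph that can be seen in a view. -/
def viewGraph (vw : LocalView) : SimpleGraph ℕ := SimpleGraph.fromEdgeSet vw.edges

/-- The facts held by the vertex with identifier `a` in a view. -/
def viewFacts (vw : LocalView) (a : ℕ) : Set ℕ :=
  {q | ∃ s, (a, s) ∈ vw.labels ∧ q ∈ decodeCert s}

/-- The facts held by the vertex with identifier `a` in a network. -/
def netFacts {V : Type*} (ident : V → ℕ) (cert : V → List Bool) (a : ℕ) : Set ℕ :=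
  {q | ∃ u, ident u = a ∧ q ∈ decodeCert (cert u)}

section View
variable {V : Type} {G : SimpleGraph V} {ident : V → ℕ} {cert : V → List Bool} {r : ℕ} {v : V}

lemma within_map_iff (hinj : Function.Injective ident) {n : ℕ} {a : ℕ} :
    Within (G.map ident) n (ident v) a ↔ ∃ u, ident u = a ∧ Within G n v u := by
  induction n generalizing a with
  | zero => simp [Within, eq_comm]
  | succ n ih =>
    constructor
    · rintro (h | ⟨z, hz, hza⟩)
      · obtain ⟨u, hu, h⟩ := ih.1 h
        exact ⟨u, hu, Or.inl h⟩
      · obtain ⟨u, rfl, h⟩ := ih.1 hz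
        obtain ⟨-, x, y, hxy, h1, rfl⟩ := hza
        cases hinj h1
        exact ⟨y, rfl, h.step hxy⟩
    · rintro ⟨u, rfl, h | ⟨z, hz, hzu⟩⟩
      · exact Or.inl (ih.2 ⟨u, rfl, h⟩)
      · exact (ih.2 ⟨z, rfl, hz⟩).step ⟨hinj.ne hzu.ne, z, u, hzu, rfl, rfl⟩

lemma viewGraph_adj_imp {d a b : ℕ}
    (h : (viewGraph (viewAt G ident cert d v)).Adj a b) : (G.map ident).Adj a b := by
  rw [viewGraph, SimpleGraph.fromEdgeSet_adj] at h
  obtain ⟨⟨u, w, huw, -, -, -, he⟩, hne⟩ := h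
  rw [Sym2.eq_iff] at he
  rcases he with ⟨rfl, rfl⟩ | ⟨rfl, rfl⟩
  · exact ⟨hne, u, w, huw, rfl, rfl⟩
  · exact ⟨hne, w, u, huw.symm, rfl, rfl⟩

/-- A view of radius `r + 1` omits only edges with both ends at distance exactly `r + 1`, so an edge
with an end within `r` is kept. -/
lemma viewGraph_adj_of_within (hinj : Function.Injective ident) {u w : V} (hu : Within G r v u)
    (h : G.Adj u w) : (viewGraph (viewAt G ident cert (r + 1) v)).Adj (ident u) (ident w) := by
  rw [viewGraph, SimpleGraph.fromEdgeSet_adj]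
  refine ⟨⟨u, w, h, within_iff_edist_le.1 (hu.mono (by omega)),
    within_iff_edist_le.1 (hu.step h), ?_, rfl⟩, hinj.ne h.ne⟩
  rintro ⟨h1, -⟩
  have h2 := within_iff_edist_le.1 hu
  rw [h1] at h2
  have : r + 1 ≤ r := by exact_mod_cast h2
  omega

lemma viewGraph_adj_iff (hinj : Function.Injective ident) {a : ℕ}
    (ha : Within (G.map ident) r (ident v) a) (b : ℕ) :
    (viewGraph (viewAt G ident cert (r + 1) v)).Adj a b ↔ (G.map ident).Adj a b := by
  refine ⟨viewGraph_adj_imp, ?_⟩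
  rintro ⟨-, x, y, hxy, rfl, rfl⟩
  obtain ⟨u, hu, hw⟩ := (within_map_iff hinj).1 ha
  cases hinj hu
  exact viewGraph_adj_of_within hinj hw hxy

lemma within_viewGraph_iff (hinj : Function.Injective ident) {n : ℕ} (hn : n ≤ r + 1) {a : ℕ} :
    Within (viewGraph (viewAt G ident cert (r + 1) v)) n (ident v) a ↔
      Within (G.map ident) n (ident v) a := by
  induction n generalizing a with
  | zero => rfl
  | succ n ih =>
    simp only [Within, ih (by omega)]
    refine or_congr Iff.rfl (exists_congr fun y => and_congr_right fun hy => ?_)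
    exact viewGraph_adj_iff hinj (hy.mono (by omega)) a

lemma viewFacts_eq (hinj : Function.Injective ident) {a : ℕ}
    (ha : Within (G.map ident) (r + 1) (ident v) a) :
    viewFacts (viewAt G ident cert (r + 1) v) a = netFacts ident cert a := by
  obtain ⟨u, rfl, hu⟩ := (within_map_iff hinj).1 ha
  ext q
  constructor
  · rintro ⟨s, ⟨x, -, hx⟩, hq⟩
    obtain ⟨h1, rfl⟩ := Prod.ext_iff.1 hx
    exact ⟨x, h1.symm, hq⟩
  · rintro ⟨x, hx, hq⟩
    cases hinj hx
    exact ⟨_, ⟨u, within_iff_edist_le.1 hu, rfl⟩, hq⟩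

/-- The verification can be carried out on the view. -/
lemma accepts_view_iff (hinj : Function.Injective ident) {N : ℕ} :
    Accepts (viewGraph (viewAt G ident cert (r + 1) v))
      (viewFacts (viewAt G ident cert (r + 1) v)) r N (ident v) ↔
    Accepts (G.map ident) (netFacts ident cert) r N (ident v) := by
  constructor
  · refine Accepts.congr (fun n hn a => within_viewGraph_iff hinj hn) ?_ ?_
    · intro a ha b
      exact viewGraph_adj_iff hinj ((within_viewGraph_iff hinj (by omega)).1 ha) b
    · intro a ha
      exact viewFacts_eq hinj ((within_viewGraph_iff hinj le_rfl).1 ha)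
  · refine Accepts.congr (fun n hn a => (within_viewGraph_iff hinj hn).symm) ?_ ?_
    · intro a ha b
      exact (viewGraph_adj_iff hinj ha b).symm
    · intro a ha
      exact (viewFacts_eq hinj ha).symm

end View

lemma map_adj_iff {V : Type} {G : SimpleGraph V} {ident : V → ℕ}
    (hinj : Function.Injective ident) {u w : V} :
    (G.map ident).Adj (ident u) (ident w) ↔ G.Adj u w := by
  constructor
  · rintro ⟨-, x, y, hxy, h1, h2⟩
    cases hinj h1; cases hinj h2; exact hxy
  · intro h
    exact ⟨hinj.ne h.ne, u, w, h, rfl, rfl⟩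

lemma indContained_iff {V : Type} {G : SimpleGraph V} {ident : V → ℕ}
    (hinj : Function.Injective ident) {N : ℕ} (hN : 2 ≤ N) :
    (SimpleGraph.pathGraph N).IsIndContained G ↔
      ∃ p, IsInducedOn (G.map ident) (Finset.range N) p := by
  constructor
  · rintro ⟨f⟩
    refine ⟨fun s => if hs : s < N then ident (f ⟨s, hs⟩) else 0, ?_⟩
    intro s hs t ht
    rw [Finset.mem_range] at hs ht
    simp only [hs, ht, dif_pos]
    refine ⟨fun h => by simpa using f.injective (hinj h), ?_⟩
    rw [map_adj_iff hinj, f.map_adj_iff, SimpleGraph.pathGraph_adj]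
  · rintro ⟨p, hp⟩
    -- Numbers that are not identifiers are isolated in the mapped graph, while every position of a
    -- path with at least two vertices has a neighbour.
    have hex : ∀ s : Fin N, ∃ u, ident u = p s := by
      intro s
      have : ∃ b, (G.map ident).Adj (p s) b := by
        by_cases h0 : (s : ℕ) = 0
        · exact ⟨p 1, (hp s (by simp) 1 (by simp; omega)).2.2 (by omega)⟩
        · exact ⟨p (s - 1), (hp s (by simp) (s - 1) (by simp; omega)).2.2 (by omega)⟩
      obtain ⟨b, -, x, y, -, h, -⟩ := this
      exact ⟨x, h⟩
    choose f hf using hex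
    refine ⟨⟨⟨f, ?_⟩, ?_⟩⟩
    · intro s t h
      have : p s = p t := by rw [← hf, ← hf, h]
      exact Fin.ext ((hp s (by simp) t (by simp)).1 this)
    · intro s t
      change G.Adj (f s) (f t) ↔ _
      rw [← map_adj_iff hinj, hf, hf, (hp s (by simp) t (by simp)).2, SimpleGraph.pathGraph_adj]

/-! ### Honest certificates: completeness and size. -/

/-- All table indices. -/
def patterns (r N : ℕ) : Finset (ℕ × Finset ℕ × ℕ × ℕ) :=
  Finset.range (r + 1) ×ˢ (Finset.range N).powerset ×ˢ Finset.range N ×ˢ Finset.range N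

lemma mem_patterns {r N h i j : ℕ} {S : Finset ℕ} :
    (h, S, i, j) ∈ patterns r N ↔ h ≤ r ∧ S ⊆ Finset.range N ∧ i < N ∧ j < N := by
  simp [patterns]

/-- A bound for the codes of the table indices. -/
def patternBound (r N : ℕ) : ℕ :=
  (patterns r N).sup fun x => patternCode x.1 x.2.1 x.2.2.1 x.2.2.2

open Classical in
/-- The neighbours of a vertex. -/
noncomputable def nbrs {V : Type} [Fintype V] (G : SimpleGraph V) (u : V) : Finset V := {w | G.Adj u w}

lemma mem_nbrs {V : Type} [Fintype V] {G : SimpleGraph V} {u w : V} :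
    w ∈ nbrs G u ↔ G.Adj u w := by simp [nbrs]

/-- The identifiers of the vertices of degree at least `m`. -/
def bigIds {V : Type} [Fintype V] (G : SimpleGraph V) (ident : V → ℕ) (m : ℕ) : Set ℕ :=
  ident '' {u | m ≤ (nbrs G u).card}

/-- A canonical name for the class of `w`. -/
noncomputable def classLabel (H : SimpleGraph ℕ) (L : Set ℕ) (d w : ℕ) : ℕ :=
  sInf {w' | SameClass H L d w w'}

lemma sameClass_classLabel {H : SimpleGraph ℕ} {L : Set ℕ} {d w : ℕ} (hw : w ∈ L) :
    SameClass H L d w (classLabel H L d w) :=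
  Nat.sInf_mem (s := {w' | SameClass H L d w w'}) ⟨w, SameClass.refl hw⟩

lemma classLabel_eq_iff {H : SimpleGraph ℕ} {L : Set ℕ} {d w w' : ℕ} (hw : w ∈ L) (hw' : w' ∈ L) :
    classLabel H L d w = classLabel H L d w' ↔ SameClass H L d w w' := by
  constructor
  · intro h
    have h1 := sameClass_classLabel (H := H) (d := d) hw
    rw [h] at h1
    exact h1.trans (sameClass_classLabel hw').symm
  · intro h
    unfold classLabel
    congr 1
    ext a
    exact ⟨fun h' => h.symm.trans h', fun h' => h.trans h'⟩

section Honest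
variable {V : Type} [Fintype V] (G : SimpleGraph V) (ident : V → ℕ) (m : ℕ) {q : ℕ}
  (κ col : V → Fin q) (r N : ℕ)

open Classical in
/-- The facts given to the vertex `v` of a graph without a long induced path. -/
noncomputable def honestFacts (v : V) : Finset ℕ :=
  -- The tags: 0 edges at small vertices, 1 large vertices, 2 class labels, 3 global table, 4
  -- private table of `v`, 5 which rows `v` carries, 6 the entries of these rows.
  (({u | ¬ m ≤ (nbrs G u).card} : Finset V).biUnion fun a =>
    (nbrs G a).image fun b => fact 0 (ident a) (ident b)) ∪
  (({u | m ≤ (nbrs G u).card} : Finset V).image fun u => fact 1 (ident u) 0) ∪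
  (({u | m ≤ (nbrs G u).card} : Finset V).image fun u =>
    fact 2 (ident u) (classLabel (G.map ident) (bigIds G ident m) (2 * r) (ident u))) ∪
  (({x ∈ Finset.univ ×ˢ patterns r N | x.2.2.2.1 = x.2.2.2.2 ∧
      Realizes (G.map ident) (bigIds G ident m) r (ident x.1) (ident x.1) x.2.1 x.2.2.1
        x.2.2.2.1 x.2.2.2.2} : Finset (V × _)).image fun x =>
    fact 3 (ident x.1) (patternCode x.2.1 x.2.2.1 x.2.2.2.1 x.2.2.2.2)) ∪
  (({x ∈ Finset.univ ×ˢ patterns r N |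
      Realizes (G.map ident) (bigIds G ident m) r (ident v) (ident x.1) x.2.1 x.2.2.1
        x.2.2.2.1 x.2.2.2.2} : Finset (V × _)).image fun x =>
    fact 4 (ident x.1) (patternCode x.2.1 x.2.2.1 x.2.2.2.1 x.2.2.2.2)) ∪
  (({z | col z = κ v} : Finset V).image fun z => fact 5 (ident z) 0) ∪
  (({z | col z = κ v} : Finset V).biUnion fun z =>
    (nbrs G z).image fun b => fact 6 (ident z) (ident b))

variable {G ident m κ col r N} {v : V}

lemma fact_zero_mem (hinj : Function.Injective ident) {a b : ℕ} :
    fact 0 a b ∈ honestFacts G ident m κ col r N v ↔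
      a ∉ bigIds G ident m ∧ (G.map ident).Adj a b := by
  simp only [honestFacts, Finset.mem_union, Finset.mem_biUnion, Finset.mem_image, Finset.mem_filter,
    Finset.mem_univ, true_and, fact_inj, mem_nbrs, OfNat.ofNat_ne_zero, one_ne_zero, false_and,
    and_false, exists_false, or_false]
  constructor
  · rintro ⟨u, hu, w, huw, rfl, rfl⟩
    refine ⟨?_, (map_adj_iff hinj).2 huw⟩
    rintro ⟨x, hx, hxu⟩
    cases hinj hxu
    exact hu hx
  · rintro ⟨ha, -, u, w, huw, rfl, rfl⟩
    exact ⟨u, fun h => ha ⟨u, h, rfl⟩, w, huw, rfl, rfl⟩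

lemma fact_one_mem {a b : ℕ} :
    fact 1 a b ∈ honestFacts G ident m κ col r N v ↔ a ∈ bigIds G ident m ∧ b = 0 := by
  simp only [honestFacts, Finset.mem_union, Finset.mem_biUnion, Finset.mem_image, Finset.mem_filter,
    Finset.mem_univ, true_and, fact_inj, OfNat.ofNat_ne_one, zero_ne_one, false_and,
    and_false, exists_false, or_false, false_or]
  constructor
  · rintro ⟨u, hu, rfl, rfl⟩
    exact ⟨⟨u, hu, rfl⟩, rfl⟩
  · rintro ⟨⟨u, hu, rfl⟩, rfl⟩
    exact ⟨u, hu, rfl, rfl⟩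

lemma fact_two_mem {a b : ℕ} :
    fact 2 a b ∈ honestFacts G ident m κ col r N v ↔ a ∈ bigIds G ident m ∧
      b = classLabel (G.map ident) (bigIds G ident m) (2 * r) a := by
  simp only [honestFacts, Finset.mem_union, Finset.mem_biUnion, Finset.mem_image, Finset.mem_filter,
    Finset.mem_univ, true_and, fact_inj, Nat.reduceEqDiff, OfNat.zero_ne_ofNat,
    OfNat.one_ne_ofNat, false_and, and_false, exists_false, or_false, false_or]
  constructor
  · rintro ⟨u, hu, rfl, rfl⟩
    exact ⟨⟨u, hu, rfl⟩, rfl⟩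
  · rintro ⟨⟨u, hu, rfl⟩, rfl⟩
    exact ⟨u, hu, rfl, rfl⟩

lemma fact_three_mem {x h i : ℕ} {S : Finset ℕ} (hh : h ≤ r) (hS : S ⊆ Finset.range N)
    (hi : i < N) :
    fact 3 x (patternCode h S i i) ∈ honestFacts G ident m κ col r N v ↔
      Realizes (G.map ident) (bigIds G ident m) r x x h S i i := by
  simp only [honestFacts, Finset.mem_union, Finset.mem_biUnion, Finset.mem_image, Finset.mem_filter,
    Finset.mem_univ, true_and, fact_inj, Nat.reduceEqDiff, OfNat.zero_ne_ofNat,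
    OfNat.one_ne_ofNat, false_and, and_false, exists_false, or_false, false_or,
    Finset.mem_product, patternCode_inj]
  constructor
  · rintro ⟨⟨u, h', S', i', j'⟩, ⟨-, -, hR⟩, h1, h2, h3, h4, h5⟩
    dsimp only at hR h1 h2 h3 h4 h5
    subst h1 h2 h3 h4 h5
    exact hR
  · intro hR
    -- Having a neighbour, as `Realizes` demands, forces `x` to be an identifier; this keeps the
    -- table finite.
    obtain ⟨b, -, u, w, -, rfl, -⟩ := hR.1
    exact ⟨⟨u, h, S, i, i⟩, ⟨mem_patterns.2 ⟨hh, hS, hi, hi⟩, rfl, hR⟩, rfl, rfl, rfl, rfl, rfl⟩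

lemma fact_four_mem {x h i j : ℕ} {S : Finset ℕ} (hh : h ≤ r) (hS : S ⊆ Finset.range N)
    (hi : i < N) (hj : j < N) :
    fact 4 x (patternCode h S i j) ∈ honestFacts G ident m κ col r N v ↔
      Realizes (G.map ident) (bigIds G ident m) r (ident v) x h S i j := by
  simp only [honestFacts, Finset.mem_union, Finset.mem_biUnion, Finset.mem_image, Finset.mem_filter,
    Finset.mem_univ, true_and, fact_inj, Nat.reduceEqDiff, OfNat.zero_ne_ofNat,
    OfNat.one_ne_ofNat, false_and, and_false, exists_false, or_false, false_or,
    Finset.mem_product, patternCode_inj]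
  constructor
  · rintro ⟨⟨u, h', S', i', j'⟩, ⟨-, hR⟩, rfl, rfl, rfl, rfl, rfl⟩
    exact hR
  · intro hR
    obtain ⟨b, -, u, w, -, rfl, -⟩ := hR.2.1
    exact ⟨⟨u, h, S, i, j⟩, ⟨mem_patterns.2 ⟨hh, hS, hi, hj⟩, hR⟩, rfl, rfl, rfl, rfl, rfl⟩

lemma fact_five_mem (hinj : Function.Injective ident) {z : V} :
    fact 5 (ident z) 0 ∈ honestFacts G ident m κ col r N v ↔ col z = κ v := by
  simp only [honestFacts, Finset.mem_union, Finset.mem_biUnion, Finset.mem_image, Finset.mem_filter,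
    Finset.mem_univ, true_and, fact_inj, Nat.reduceEqDiff, OfNat.zero_ne_ofNat,
    OfNat.one_ne_ofNat, false_and, and_false, exists_false, or_false, false_or, and_true,
    hinj.eq_iff, exists_eq_right]

lemma fact_six_mem (hinj : Function.Injective ident) {z : V} {b : ℕ} :
    fact 6 (ident z) b ∈ honestFacts G ident m κ col r N v ↔
      col z = κ v ∧ (G.map ident).Adj (ident z) b := by
  simp only [honestFacts, Finset.mem_union, Finset.mem_biUnion, Finset.mem_image, Finset.mem_filter,
    Finset.mem_univ, true_and, fact_inj, Nat.reduceEqDiff, OfNat.zero_ne_ofNat,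
    OfNat.one_ne_ofNat, false_and, and_false, exists_false, false_or, hinj.eq_iff, mem_nbrs]
  constructor
  · rintro ⟨z', hz', w, hw, rfl, rfl⟩
    exact ⟨hz', (map_adj_iff hinj).2 hw⟩
  · rintro ⟨hz, -, x, y, hxy, h1, rfl⟩
    cases hinj h1
    exact ⟨_, hz, y, hxy, rfl, rfl⟩

/-- Only the tags 4, 5 and 6 depend on the holder of the certificate. -/
lemma global_fact_mem (v' : V) {t : ℕ} (ht : t ≤ 3) {a b : ℕ} :
    fact t a b ∈ honestFacts G ident m κ col r N v ↔
      fact t a b ∈ honestFacts G ident m κ col r N v' := by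
  simp only [honestFacts, Finset.mem_union, Finset.mem_biUnion, Finset.mem_image,
    fact_inj]
  have h4 : ¬ 4 = t := by omega
  have h5 : ¬ 5 = t := by omega
  have h6 : ¬ 6 = t := by omega
  simp only [h4, h5, h6, false_and, and_false, exists_false, or_false]

/-- The honest facts are accepted. -/
lemma accepts_honest (hinj : Function.Injective ident)
    (hκ : ∀ w, m ≤ (nbrs G w).card → ∀ i, ∃ u ∈ nbrs G w, κ u = i) {Φ : ℕ → Set ℕ}
    (hΦ : ∀ u, Φ (ident u) = honestFacts G ident m κ col r N u)
    (hfree : ¬ ∃ p, IsInducedOn (G.map ident) (Finset.range N) p) :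
    Accepts (G.map ident) Φ r N (ident v) := by
  have hbig : bigSet (Φ (ident v)) = bigIds G ident m := by
    ext w
    rw [bigSet, hΦ]
    exact fact_one_mem.trans (by simp)
  have hnb : ∀ w u : ℕ, w ∈ Set.range ident → (u = w ∨ (G.map ident).Adj w u) →
      u ∈ Set.range ident := by
    rintro w u hw (rfl | ⟨-, x, y, hxy, rfl, rfl⟩)
    · exact hw
    · exact ⟨y, rfl⟩
  refine ⟨?_, ?_, ?_, ?_⟩
  · rintro u ⟨-, x, y, hxy, h1, rfl⟩ t ht a b
    rw [hΦ, hΦ]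
    exact global_fact_mem v ht
  · intro hv b
    rw [hbig] at hv
    rw [hΦ, Finset.mem_coe, fact_zero_mem hinj]
    exact ⟨fun h => h.2, fun h => ⟨hv, h⟩⟩
  · rintro ⟨p, hp1, hp2⟩
    refine hfree ⟨p, fun s hs t ht => ⟨(hp2 s hs t ht).1, ?_⟩⟩
    rw [← (hp2 s hs t ht).2]
    rw [Finset.mem_range] at hs ht
    have h1 := hp1 s hs
    have h2 := hp1 t ht
    rw [hbig] at h1 h2
    change _ ↔ _ ∧ _ ∧ _
    rw [hΦ, Finset.mem_coe, Finset.mem_coe, fact_zero_mem hinj, fact_zero_mem hinj]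
    exact ⟨fun h => ⟨h.ne, ⟨h1, h⟩, h2, h.symm⟩, fun h => h.2.1.2⟩
  · intro _
    -- The honest belief is the true graph.
    refine ⟨G.map ident, ?_, ?_, ?_, ?_, ?_, ?_, fun _ _ => Iff.rfl, hfree⟩
    · intro w _ hw z hz
      rw [hbig] at hw hz
      obtain ⟨w, hw, rfl⟩ := hw
      obtain ⟨z, hz, rfl⟩ := hz
      obtain ⟨u, hu, hcol⟩ := hκ w hw (col z)
      refine ⟨ident u, Or.inr ((map_adj_iff hinj).2 (mem_nbrs.1 hu)), ?_⟩
      rw [hΦ, Finset.mem_coe, fact_five_mem hinj, hcol]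
    · intro w _ hw z hz u hu hf b
      rw [hbig] at hw hz
      obtain ⟨w, hw, rfl⟩ := hw
      obtain ⟨z, hz, rfl⟩ := hz
      obtain ⟨u, rfl⟩ := hnb _ u ⟨w, rfl⟩ hu
      rw [hΦ, Finset.mem_coe] at hf ⊢
      rw [fact_five_mem hinj] at hf
      rw [fact_six_mem hinj]
      exact ⟨fun h => h.2, fun h => ⟨hf, h⟩⟩
    · rw [hbig]
      intro a ha b
      rw [hΦ, Finset.mem_coe, fact_zero_mem hinj]
      exact ⟨fun h => h.2, fun h => ⟨ha, h⟩⟩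
    · rw [hbig]
      intro w hw w' hw'
      simp only [hΦ, Finset.mem_coe, fact_two_mem]
      rw [← classLabel_eq_iff hw hw']
      constructor
      · intro h
        exact ⟨_, ⟨hw, rfl⟩, hw', h⟩
      · rintro ⟨l, ⟨-, h1⟩, -, h2⟩
        rw [← h1, h2]
    · rw [hbig]
      intro x h hh S hS i hi
      rw [hΦ, Finset.mem_coe, fact_three_mem hh hS hi]
    · rw [hbig]
      intro x hx u h hh S hS i hi j hj
      obtain ⟨x, rfl, -⟩ := (within_map_iff hinj).1 hx
      rw [hΦ, Finset.mem_coe, fact_four_mem hh hS hi hj]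

lemma card_honestFacts_le (v : V) {x : ℕ} (hcol : ∀ i, ({z | col z = i} : Finset V).card ≤ x) :
    (honestFacts G ident m κ col r N v).card ≤
      Fintype.card V * m + Fintype.card V + Fintype.card V +
      Fintype.card V * (patterns r N).card + Fintype.card V * (patterns r N).card + x +
      x * Fintype.card V := by
  classical
  have hle : ∀ s : Finset V, s.card ≤ Fintype.card V := Finset.card_le_univ
  have hpat : ∀ (P : V × ℕ × Finset ℕ × ℕ × ℕ → Prop) [DecidablePred P], ∀ f : V × ℕ × Finset ℕ × ℕ × ℕ → ℕ,
      (({x ∈ Finset.univ ×ˢ patterns r N | P x} :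
        Finset (V × ℕ × Finset ℕ × ℕ × ℕ)).image f).card ≤
      Fintype.card V * (patterns r N).card := by
    intro P _ f
    refine Finset.card_image_le.trans ?_
    refine (Finset.card_filter_le _ _).trans ?_
    rw [Finset.card_product, Finset.card_univ]
  unfold honestFacts
  refine (Finset.card_union_le _ _).trans (Nat.add_le_add ?_ ?_)
  · refine (Finset.card_union_le _ _).trans (Nat.add_le_add ?_ ?_)
    · refine (Finset.card_union_le _ _).trans (Nat.add_le_add ?_ ?_)
      · refine (Finset.card_union_le _ _).trans (Nat.add_le_add ?_ ?_)
        · refine (Finset.card_union_le _ _).trans (Nat.add_le_add ?_ ?_)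
          · refine (Finset.card_union_le _ _).trans (Nat.add_le_add ?_ ?_)
            · refine (Finset.card_biUnion_le_card_mul _ _ m ?_).trans
                (Nat.mul_le_mul_right _ (hle _))
              intro a ha
              simp only [Finset.mem_filter, Finset.mem_univ, true_and, not_le] at ha
              exact Finset.card_image_le.trans ha.le
            · exact Finset.card_image_le.trans (hle _)
          · exact Finset.card_image_le.trans (hle _)
        · apply hpat
      · apply hpat
    · refine Finset.card_image_le.trans ?_
      convert hcol (κ v)
  · refine (Finset.card_biUnion_le_card_mul _ _ (Fintype.card V) ?_).trans
      (Nat.mul_le_mul_right _ ?_)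
    · intro a _
      exact Finset.card_image_le.trans (hle _)
    · convert hcol (κ v)

lemma fact_lt {t a b M : ℕ} (ht : t < M) (ha : a < M) (hb : b < M) : fact t a b < M ^ 4 := by
  have h1 : Nat.pair a b < M ^ 2 := (Nat.pair_lt_max_add_one_sq a b).trans_le
    (Nat.pow_le_pow_left (by omega) 2)
  have h2 : t < M ^ 2 := lt_of_lt_of_le ht (by nlinarith)
  calc fact t a b < (max t (Nat.pair a b) + 1) ^ 2 := Nat.pair_lt_max_add_one_sq _ _
    _ ≤ (M ^ 2) ^ 2 := Nat.pow_le_pow_left (by omega) 2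
    _ = M ^ 4 := by ring

lemma size_honestFacts_le {B : ℕ} (hB : ∀ u, ident u ≤ B) {y : ℕ}
    (hy : y ∈ honestFacts G ident m κ col r N v) :
    y.size ≤ 4 * (B + patternBound r N + 7).size := by
  -- The summand 7 keeps all tags below `M`; two nested pairings then give the bound `M ^ 4`.
  set M := B + patternBound r N + 7 with hM
  have hid : ∀ u, ident u < M := fun u => by have := hB u; omega
  have hlab : ∀ u, m ≤ (nbrs G u).card →
      classLabel (G.map ident) (bigIds G ident m) (2 * r) (ident u) < M := by
    intro u hu
    -- A class label is a member of the class, hence itself an identifier.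
    obtain ⟨w, -, hw⟩ := (sameClass_classLabel (H := G.map ident) (d := 2 * r)
      (show ident u ∈ bigIds G ident m from ⟨u, hu, rfl⟩)).2.1
    rw [← hw]
    exact hid w
  have hcode : ∀ x ∈ patterns r N, patternCode x.1 x.2.1 x.2.2.1 x.2.2.2 < M := by
    intro x hx
    have := Finset.le_sup (f := fun x : ℕ × Finset ℕ × ℕ × ℕ =>
      patternCode x.1 x.2.1 x.2.2.1 x.2.2.2) hx
    change _ ≤ patternBound r N at this
    omega
  have hlt : y < M ^ 4 := by
    simp only [honestFacts, Finset.mem_union, Finset.mem_biUnion, Finset.mem_image,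
      Finset.mem_filter, Finset.mem_univ, true_and, Finset.mem_product] at hy
    rcases hy with (((((⟨a, -, b, -, rfl⟩ | ⟨u, -, rfl⟩) | ⟨u, hu, rfl⟩) | ⟨x, ⟨hx, -⟩, rfl⟩) |
      ⟨x, ⟨hx, -⟩, rfl⟩) | ⟨z, -, rfl⟩) | ⟨z, -, b, -, rfl⟩
    · exact fact_lt (by omega) (hid _) (hid _)
    · exact fact_lt (by omega) (hid _) (by omega)
    · exact fact_lt (by omega) (hid _) (hlab u hu)
    · exact fact_lt (by omega) (hid _) (hcode _ hx)
    · exact fact_lt (by omega) (hid _) (hcode _ hx)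
    · exact fact_lt (by omega) (hid _) (by omega)
    · exact fact_lt (by omega) (hid _) (hid _)
  rw [Nat.size_le]
  calc y < M ^ 4 := hlt
    _ ≤ (2 ^ M.size) ^ 4 := Nat.pow_le_pow_left (Nat.lt_size_self M).le 4
    _ = 2 ^ (4 * M.size) := by rw [← pow_mul, mul_comm]

end Honest

/-! ### Choice of parameters and conclusion. -/

theorem mainTheorem2 (k : ℕ) (hk : 2 ≤ k) (c : ℕ) :
    ∃ s : ℕ → ℕ,
      (fun n : ℕ => (s n : ℝ)) =O[atTop]
        (fun n : ℕ => (n : ℝ) ^ (3 / 2 : ℝ) * Real.log (n : ℝ) ^ 2) ∧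
      HasLocalCertification
        (fun _ G => InducedFree (SimpleGraph.pathGraph (⌈(14 / 3 : ℚ) * (k : ℚ)⌉₊ - 1)) G)
        k c s := by
  classical
  set N := ⌈(14 / 3 : ℚ) * (k : ℚ)⌉₊ - 1 with hNdef
  have hk2 : (2 : ℚ) ≤ k := by exact_mod_cast hk
  have hceil : 9 < ⌈(14 / 3 : ℚ) * (k : ℚ)⌉₊ := by
    rw [Nat.lt_ceil]; push_cast; linarith
  have hN2 : 2 ≤ N := by omega
  obtain ⟨r, rfl⟩ : ∃ r, k = r + 1 := ⟨k - 1, by omega⟩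
  have hN : 3 * N < 14 * (r + 1) := by
    have h : N < ⌈(14 / 3 : ℚ) * ((r + 1 : ℕ) : ℚ)⌉₊ := by omega
    rw [Nat.lt_ceil] at h
    have h2 : (3 * N : ℚ) < 14 * ((r + 1 : ℕ) : ℚ) := by linarith
    exact_mod_cast h2
  refine ⟨certSize c (patterns r N).card (patternBound r N), certSize_isBigO _ _ _,
    fun vw => decide (Accepts (viewGraph vw) (viewFacts vw) r N vw.center), ?_⟩
  intro V _ G ident ⟨hinj, hid⟩
  have hacc : ∀ cert v, decide (Accepts (viewGraph (viewAt G ident cert (r + 1) v))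
      (viewFacts (viewAt G ident cert (r + 1) v)) r N (viewAt G ident cert (r + 1) v).center) =
        true ↔ Accepts (G.map ident) (netFacts ident cert) r N (ident v) := by
    intro cert v
    rw [decide_eq_true_iff]
    exact accepts_view_iff hinj
  constructor
  · intro hP
    rw [InducedFree, indContained_iff hinj hN2] at hP
    set n := Fintype.card V with hn
    have hlt : n * (Nat.sqrt n + 1) < 2 ^ (2 * n.size) := by
      have h1 : n < 2 ^ n.size := Nat.lt_size_self n
      have h2 : Nat.sqrt n + 1 ≤ 2 ^ n.size := by have := Nat.sqrt_le_self n; omega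
      rw [two_mul, pow_add]
      exact Nat.mul_lt_mul_of_lt_of_le h1 h2 (by omega)
    -- With q colours the degree threshold is 2q · `n.size`. Edges at small vertices then cost about
    -- n · q · log n facts and the rows about n²/q, which q ≈ √n balances up to the logarithm.
    obtain ⟨κ, hκ⟩ := exists_coloring (nbrs G) (Nat.sqrt n + 1) (2 * n.size) (by omega) hlt
    obtain ⟨col, hcol⟩ := exists_balanced (V := V) (Nat.sqrt n + 1) (by omega)
    refine ⟨fun v => encodeCert
      (honestFacts G ident ((Nat.sqrt n + 1) * (2 * n.size)) κ col r N v), ?_, ?_⟩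
    · intro v
      refine (length_encodeCert_le fun y hy => size_honestFacts_le (fun u => (hid u).2) hy).trans ?_
      exact Nat.mul_le_mul_right _ (card_honestFacts_le v hcol)
    · intro v
      rw [hacc]
      refine accepts_honest (col := col) hinj hκ (fun u => ?_) hP
      ext y
      constructor
      · rintro ⟨u', hu', hy⟩
        cases hinj hu'
        rwa [decodeCert_encodeCert] at hy
      · intro hy
        exact ⟨u, rfl, by rwa [decodeCert_encodeCert]⟩
  · intro hP cert
    have hpath := (indContained_iff hinj hN2).1 (not_not.1 hP)
    by_contra hall
    simp only [not_exists, Bool.not_eq_false] at hall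
    refine not_path_of_accepts (Φ := netFacts ident cert) (r := r) (by omega) hN2 hN ?_ hpath
    rintro a ⟨b, -, x, y, -, rfl, -⟩
    exact (hacc cert x).1 (hall x)
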